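/- **Setting.** Words are in the letters $X,\bar X=X^{-1},Y,\bar Y=Y^{-1}$; subwords of a relator $R=R(X,Y)$ are taken cyclically. For a word $W$ let $\varphi(W)$ be the number of $X$ minus the number of $\bar X$ in $W$. A presentation $\langle X,Y\mid R\rangle$ with $R$ cyclically reduced is *quasi-geometric* if (1) $\varphi(R)=1$; (2) every subword $XY^k\bar X$ or $\bar XY^kX$ of $R$ has $|k|=1$; (3) whenever $XY^lX$ or $\bar X\bar Y^l\bar X$, and $XY^{l'}X$ or $\bar X\bar Y^{l'}\bar X$, are subwords of $R$ ($l,l'\in\mathbb Z$), then $|l-l'|\le 1$. *Primitive disk words.* Let $W=W_1^n$ be a subword of $R$ that begins and ends with an $X$-letter (i.e. $X$ or $\bar X$), has $n$ $X$-letters, and write $W_a^b$ for its subword from the $a$-th to the $b$-th $X$-letter. $W$ is a *primitive disk word* if its first and last letters have opposite signs, $\varphi(W)=0$, and $\varphi(W_1^k)\neq0$ for $1<k<n$. It is *upward* if it begins with $X$ and *downward* otherwise. It is *positive* if it contains more of the words $X\bar Y\bar X,\ \bar XYX$ than of the words $XY\bar X,\ \bar X\bar YX$, and *negative* otherwise.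 (The difference of the two numbers is odd; it is $\pm1$ for a word realized by a bigon.) *The pair $P(W)=(n_z(W),n_w(W))$* is defined recursively. - $P(XY\bar X)=(0,-1)$, $P(X\bar Y\bar X)=(0,1)$, $P(\bar XYX)=(1,0)$, $P(\bar X\bar YX)=(-1,0)$. - Let $W$ be upward and positive with $n>2$, beginning with $XY^lX$ and ending with $\bar X\bar Y^{l'}\bar X$. Let $k_1=2<\dots<k_{d+1}=n-1$ be the indices of the $X$-letters of height one, where the height of the $i$-th $X$-letter is $\varphi(W_1^i)-1$ if it is $X$ and $\varphi(W_1^i)$ if it is $\bar X$. Then $P(W)=P(S)+\sum_{i=1}^dP(W_{k_i}^{k_{i+1}})$, where $P(S)=(1,0)$ if $l-l'=1$; $P(S)=(0,1)$ if $l'-l=1$; and if $l=l'$, then $P(S)=(1,1)$ when $d\ge2$ and both $W_{k_1}^{k_2}$ and $W_{k_d}^{k_{d+1}}$ are positive, and $P(S)=(0,0)$ otherwise. - If $W$ is upward and negative, $P(W)=-P(\widetilde W)$, where $\widetilde W$ is $W$ with all $Y$-letters inverted. If $W$ is downward and negative, $P(W)=-(n_w(\widetilde W),n_z(\widetilde W))$,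 where $\widetilde W$ is $W$ with all $X$-letters inverted. If $W$ is downward and positive, $P(W)=(n_w(\widetilde W),n_z(\widetilde W))$, where $\widetilde W$ is $W$ with all letters inverted in place. *The complex.* Its generators $x_i$ correspond to the $X$-letters of $R$, and its differential is zero. Relative gradings $F$ (Alexander) and $M$ (Maslov) are integer-valued functions on the generators such that, for every primitive disk word $W$ of $R$ from the letter of $x_i$ to the letter of $x_j$, $$F(x_i)-F(x_j)=n_z(W)-n_w(W),\qquad M(x_i)-M(x_j)=\begin{cases}\ \ 1-2n_w(W)&W\text{ positive},\\-1-2n_w(W)&W\text{ negative}.\end{cases}$$ *The knot.* A $(1,1)$ knot is a (tame) knot $K\subset S^3$ for which $S^3$ is a union of two solid tori meeting in their common boundary torus, each of which meets $K$ in a single trivial arc. Let $G=\pi_1(S^3\setminus K)$, $C=[G,G]$, $\Lambda=\mathbb Z[t,t^{-1}]$. If $\langle X,Y\mid R\rangle$ with $\varphi(R)=1$ presents $G$, the class of $Y$ generates $G/C\cong\mathbb Z$; let $t$ act on $C/[C,C]$ by $c\mapsto Y^{-1}cY$. The Alexander polynomial $\Delta_K(t)$, defined up to a factor $\pm t^c$,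 is determined by $C/[C,C]\cong\Lambda/(\Delta_K(t))$ as $\Lambda$-modules. ($C/[C,C]$ is $H_1$ of the infinite cyclic cover of $S^3\setminus K$.) **Proposition 5.1.** Let $\langle X,Y\mid R\rangle$ be a quasi-geometric presentation of the group $\pi_1(S^3\setminus K)$ of a $(1,1)$ knot $K\subset S^3$. Then relative gradings $F$ and $M$ as above exist, and each of them is unique up to an additive constant, so that one obtains a relatively bigraded chain complex with zero differential. Its graded Euler characteristic satisfies $$\sum_{m,s}(-1)^m\operatorname{rank}(C_{m,s})\,t^s=\sum_i(-1)^{M(x_i)}t^{F(x_i)}\ \overset{\circ}{=}\ \Delta_K(t),$$ where $C_{m,s}$ is spanned by the generators with $M=m$ and $F=s$, and $f\overset{\circ}{=}g$ means $f=\pm t^cg$ for some integer $c$. In particular $\Delta_K(t)$ exists, i.e. $C/[C,C]$ is cyclic of the form $\Lambda/(\Delta_K(t))$. -/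

import Mathlib

noncomputable section

namespace OneOneKnot

/-! ## Words in the letters `X`, `Y` and their inverses -/

/-- A letter: the generator `X` is `0`, the generator `Y` is `1`; the Boolean is `true` for the
generator itself and `false` for its inverse.  Words are lists of letters, exactly as in
`FreeGroup (Fin 2)`. -/
abbrev Letter := Fin 2 × Bool

abbrev lX : Letter := (0, true)
abbrev lX' : Letter := (0, false)
abbrev lY : Letter := (1, true)
abbrev lY' : Letter := (1, false)

/-- The word `Y ^ k` for an integer `k`. -/
def yPow (k : ℤ) : List Letter := List.replicate k.natAbs (1, decide (0 ≤ k))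

/-- The signed number of occurrences of the generator `g` in a word. -/
def expSum (g : Fin 2) (W : List Letter) : ℤ :=
  (W.count (g, true) : ℤ) - (W.count (g, false) : ℤ)

/-- `φ(W)`: the number of letters `X` minus the number of letters `X⁻¹`. -/
abbrev phi (W : List Letter) : ℤ := expSum 0 W

/-- The number of `X`-letters (of either sign) of a word. -/
def xCount (W : List Letter) : ℕ := W.count lX + W.count lX'

/-- `U` is a subword of the cyclic word `R` (running at most once around it). -/
def IsCyclicSubword (U R : List Letter) : Prop := ∃ i : ℕ, U <+: R.rotate i

/-- `X Y^l X` or `X⁻¹ Y^(-l) X⁻¹` is a subword of the cyclic word `R`. -/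
def HasSameSignGap (R : List Letter) (l : ℤ) : Prop :=
  IsCyclicSubword (lX :: (yPow l ++ [lX])) R ∨ IsCyclicSubword (lX' :: (yPow (-l) ++ [lX'])) R

/-- Quasi-geometric relators in `X` and `Y`. -/
structure IsQuasiGeometric (R : List Letter) : Prop where
  cyclicallyReduced : FreeGroup.IsCyclicallyReduced R
  phi_eq_one : phi R = 1
  turn_up : ∀ k : ℤ, IsCyclicSubword (lX :: (yPow k ++ [lX'])) R → |k| = 1
  turn_down : ∀ k : ℤ, IsCyclicSubword (lX' :: (yPow k ++ [lX])) R → |k| = 1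
  gap : ∀ l l' : ℤ, HasSameSignGap R l → HasSameSignGap R l' → |l - l'| ≤ 1

/-! ## Primitive disk words, orientation, numbers of base points -/

/-- A disk word: the first and last letter are `X`-letters of opposite signs and `φ(W) = 0`. -/
def IsDiskWord (W : List Letter) : Prop :=
  ((W.head? = some lX ∧ W.getLast? = some lX') ∨
    (W.head? = some lX' ∧ W.getLast? = some lX)) ∧ phi W = 0

/-- A disk word is primitive if `φ` does not vanish on a proper nonempty initial subword.  (`φ` of
an initial subword depends only on the last `X`-letter that it contains.) -/
def IsPrimitiveDiskWord (W : List Letter) : Prop :=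
  IsDiskWord W ∧ ∀ k : ℕ, 0 < k → k < W.length → phi (W.take k) ≠ 0

/-- The number of occurrences of the positive elementary words `X Y⁻¹ X⁻¹`, `X⁻¹ Y X` minus the
number of occurrences of the negative elementary words `X Y X⁻¹`, `X⁻¹ Y⁻¹ X`. -/
def orientationCount (W : List Letter) : ℤ :=
  (W.tails.countP (fun V => [lX, lY', lX'].isPrefixOf V || [lX', lY, lX].isPrefixOf V) : ℤ) -
  (W.tails.countP (fun V => [lX, lY, lX'].isPrefixOf V || [lX', lY', lX].isPrefixOf V) : ℤ)

/-- Orientation of a primitive disk word: it is positive if it contains more positive than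
negative elementary words, and negative otherwise.  The difference is odd in a quasi-geometric
relator; for a word that is realized by a bigon it is `1` or `-1`. -/
def IsPositive (W : List Letter) : Prop := 0 < orientationCount W

instance (W : List Letter) : Decidable (IsPositive W) :=
  inferInstanceAs (Decidable (0 < orientationCount W))

/-- A primitive disk word is upward if it starts with `X`, and downward if with `X⁻¹`. -/
def IsUpward (W : List Letter) : Prop := W.head? = some lX

instance (W : List Letter) : Decidable (IsUpward W) :=
  inferInstanceAs (Decidable (W.head? = some lX))

/-- Replace each letter that belongs to the generator `g` by its inverse. -/
def invertGen (g : Fin 2) (W : List Letter) : List Letter :=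
  W.map fun a => if a.1 = g then (a.1, !a.2) else a

/-- The upward positive word that belongs to a primitive disk word. -/
def toUpwardPositive (W : List Letter) : List Letter :=
  if IsUpward W then
    if IsPositive W then W else invertGen 1 W
  else
    if IsPositive W then invertGen 0 (invertGen 1 W) else invertGen 0 W

/-- The pair `(n_z, n_w)` of `W`, if `q` is that of `toUpwardPositive W`. -/
def fromUpwardPositive (W : List Letter) (q : ℤ × ℤ) : ℤ × ℤ :=
  if IsUpward W then
    if IsPositive W then q else (-q.1, -q.2)
  else
    if IsPositive W then (q.2, q.1) else (-q.2, -q.1)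

/-- Height of the `X`-letter at position `i` in an upward disk word `W`: the value of `φ` on the
initial subword that ends at this letter, minus one if the letter is `X`. -/
def height (W : List Letter) (i : ℕ) : ℤ :=
  phi (W.take (i + 1)) - (if W[i]? = some lX then 1 else 0)

/-- The positions of the `X`-letters of height one in `W`, in increasing order. -/
def heightOne (W : List Letter) : List ℕ :=
  (List.range W.length).filter fun i =>
    decide ((W[i]? = some lX ∨ W[i]? = some lX') ∧ height W i = 1)

/-- The subwords of `W` between consecutive `X`-letters of height one (end letters included). -/
def pieces (W : List Letter) : List (List Letter) :=
  ((heightOne W).zip (heightOne W).tail).map fun p => (W.drop p.1).take (p.2 + 1 - p.1)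

/-- The pair `P(S)` of an upward positive primitive disk word with more than two `X`-letters.
Such a word starts with `X Y^l X` and ends with `X⁻¹ Y^(-l') X⁻¹`, where the second and the
last but one `X`-letter are the first and the last one of height one. -/
def squareCount (W : List Letter) : ℤ × ℤ :=
  let l : ℤ := expSum 1 (W.take ((heightOne W).headD 0))
  let l' : ℤ := -expSum 1 (W.drop ((heightOne W).getLastD 0))
  if l - l' = 1 then (1, 0)
  else if l' - l = 1 then (0, 1)
  else if l = l' ∧ 2 ≤ (pieces W).length ∧ (∀ U ∈ (pieces W).head?, IsPositive U) ∧
      (∀ U ∈ (pieces W).getLast?, IsPositive U) then (1, 1)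
  else (0, 0)

/-- The pair `(n_z, n_w)` of the four elementary disk words. -/
def elementaryCount (W : List Letter) : ℤ × ℤ :=
  if W = [lX, lY, lX'] then (0, -1)
  else if W = [lX, lY', lX'] then (0, 1)
  else if W = [lX', lY, lX] then (1, 0)
  else if W = [lX', lY', lX] then (-1, 0)
  else (0, 0)

theorem pos_of_mem_heightOne {W : List Letter} {i : ℕ} (h : i ∈ heightOne W) :
    0 < i ∧ i < W.length := by
  simp only [heightOne, List.mem_filter, List.mem_range, decide_eq_true_eq] at h
  obtain ⟨h1, h2, h3⟩ := h
  refine ⟨Nat.pos_of_ne_zero ?_, h1⟩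
  rintro rfl
  cases W with
  | nil => simp at h1
  | cons a t =>
    rcases h2 with h2 | h2 <;> simp at h2 <;> subst h2 <;>
      simp [height, phi, expSum] at h3

theorem length_lt_of_mem_pieces {U W : List Letter} (h : U ∈ pieces W) :
    U.length < W.length := by
  simp only [pieces, List.mem_map] at h
  obtain ⟨p, hp, rfl⟩ := h
  have := pos_of_mem_heightOne (List.of_mem_zip hp).1
  simp only [List.length_take, List.length_drop]
  omega

theorem length_toUpwardPositive (W : List Letter) :
    (toUpwardPositive W).length = W.length := by
  unfold toUpwardPositive invertGen
  split_ifs <;> simp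

/-- The pair `P(W) = (n_z(W), n_w(W))` of a primitive disk word, by recursion on its length. -/
def basepoints (W : List Letter) : ℤ × ℤ :=
  if xCount W = 2 then elementaryCount W
  else
    fromUpwardPositive W
      (squareCount (toUpwardPositive W) +
        ((pieces (toUpwardPositive W)).attach.map fun U => basepoints U.1).sum)
termination_by W.length
decreasing_by
  exact (length_lt_of_mem_pieces U.2).trans_eq (length_toUpwardPositive W)

/-! ## The bigraded chain complex -/

/-- The generators `x_i`: the `X`-letters (of either sign) of `R`, as positions in `R`. -/
abbrev XLetter (R : List Letter) := {i : Fin R.length // (R.get i).1 = 0}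

/-- `W` is a primitive disk word of the cyclic word `R` running from the letter `i` to the
letter `j`. -/
def Connects (R W : List Letter) (i j : XLetter R) : Prop :=
  IsPrimitiveDiskWord W ∧ W <+: R.rotate i.1 ∧ ((i.1 : ℕ) + W.length - 1) % R.length = j.1

/-- `F` is a relative Alexander grading of the generators. -/
def IsAlexanderGrading (R : List Letter) (F : XLetter R → ℤ) : Prop :=
  ∀ (W : List Letter) (i j : XLetter R), Connects R W i j →
    F i - F j = (basepoints W).1 - (basepoints W).2

/-- `M` is a relative Maslov grading of the generators. -/
def IsMaslovGrading (R : List Letter) (M : XLetter R → ℤ) : Prop :=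
  ∀ (W : List Letter) (i j : XLetter R), Connects R W i j →
    M i - M j = (if IsPositive W then 1 else -1) - 2 * (basepoints W).2

/-- The summand in Alexander grading `s` of the chain complex: in degree `m` it is free abelian on
the generators with `F = s` and `M = m`, and the differential is zero. -/
def chainComplex {R : List Letter} (F M : XLetter R → ℤ) (s : ℤ) :
    ChainComplex (ModuleCat.{0} ℤ) ℤ where
  X m := ModuleCat.of ℤ ({x : XLetter R // F x = s ∧ M x = m} →₀ ℤ)
  d _ _ := 0

/-- Graded Euler characteristic `∑ (-1)^m rank (C_s)_m t^s` of a family of complexes of abelian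
groups (all but finitely many of the ranks being zero). -/
def gradedEulerChar (C : ℤ → ChainComplex (ModuleCat.{0} ℤ) ℤ) : LaurentPolynomial ℤ :=
  ∑ᶠ p : ℤ × ℤ, LaurentPolynomial.C
    ((p.1.negOnePow : ℤ) * (Module.finrank ℤ ((C p.2).X p.1) : ℤ)) * LaurentPolynomial.T p.2

/-- Equality of Laurent polynomials up to a factor `±t^c`. -/
def EqUpToUnit (f g : LaurentPolynomial ℤ) : Prop :=
  ∃ c : ℤ, f = LaurentPolynomial.T c * g ∨ f = -(LaurentPolynomial.T c * g)

/-! ## The Alexander polynomial -/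

section Alexander

variable {G : Type*} [Group G]

/-- The abelian group `C / [C, C]`, written additively, where `C = [G, G]`.  It is a
`ℤ[t, t⁻¹]`-module, `t` acting by `c ↦ s⁻¹ c s`; this depends only on the class of `s` in the
abelianization of `G`.  For a knot group it is the first homology group of the infinite cyclic
cover of the knot complement. -/
def AlexanderModule (_s : G) : Type _ := Additive (Abelianization (commutator G))

instance (s : G) : AddCommGroup (AlexanderModule s) :=
  inferInstanceAs (AddCommGroup (Additive (Abelianization (commutator G))))

/-- The class in `C / [C, C]` of an element of the commutator subgroup `C`. -/
def AlexanderModule.mk (s : G) (c : commutator G) : AlexanderModule s :=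
  Additive.ofMul (Abelianization.of c)

/-- The action of `g` on `C / [C, C]` by `c ↦ g c g⁻¹`. -/
def conjAction (s g : G) : AlexanderModule s →+ AlexanderModule s :=
  MonoidHom.toAdditive
    (Abelianization.map (MulAut.conjNormal (H := commutator G) g).toMonoidHom)

theorem conjAction_mk (s g : G) (c : commutator G) :
    conjAction s g (AlexanderModule.mk s c) =
      AlexanderModule.mk s (MulAut.conjNormal g c) := rfl

theorem AlexanderModule.mk_surjective (s : G) : Function.Surjective (AlexanderModule.mk s) := by
  intro a
  obtain ⟨c, hc⟩ := QuotientGroup.mk_surjective (Additive.toMul (show Additive _ from a))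
  exact ⟨c, congrArg Additive.ofMul hc⟩

/-- The action of the powers of `t`: `t^n` acts by conjugation with `s^(-n)`. -/
def tAction (s : G) : Multiplicative ℤ →* Module.End ℤ (AlexanderModule s) where
  toFun n := (conjAction s (s ^ (-n.toAdd))).toIntLinearMap
  map_one' := by
    ext a
    obtain ⟨c, rfl⟩ := AlexanderModule.mk_surjective s a
    simp [conjAction_mk]
  map_mul' m n := by
    ext a
    obtain ⟨c, rfl⟩ := AlexanderModule.mk_surjective s a
    simp [conjAction_mk, zpow_add, add_comm]

instance (s : G) : Module (LaurentPolynomial ℤ) (AlexanderModule s) :=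
  Module.compHom _
    (AddMonoidAlgebra.lift ℤ (Module.End ℤ (AlexanderModule s)) ℤ (tAction s)).toRingHom

theorem T_smul_mk (s : G) (n : ℤ) (c : commutator G) :
    (LaurentPolynomial.T n : LaurentPolynomial ℤ) • AlexanderModule.mk s c =
      AlexanderModule.mk s (MulAut.conjNormal (s ^ (-n)) c) := by
  change (AddMonoidAlgebra.lift ℤ (Module.End ℤ (AlexanderModule s)) ℤ (tAction s))
    (LaurentPolynomial.T n) (AlexanderModule.mk s c) = _
  rw [LaurentPolynomial.T, AddMonoidAlgebra.lift_single]
  simp [tAction, conjAction_mk]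

/-- `Δ` is an Alexander polynomial of `G`, where the class of `s` generates the abelianization
of `G`: there is an isomorphism `C / [C, C] ≅ ℤ[t, t⁻¹] / (Δ)` of `ℤ[t, t⁻¹]`-modules.  (The
Alexander module of a (1,1) knot is cyclic.) -/
def IsAlexanderPolynomial (s : G) (Δ : LaurentPolynomial ℤ) : Prop :=
  (∀ a : Abelianization G, a ∈ Subgroup.zpowers (Abelianization.of s)) ∧
  Nonempty (AlexanderModule s ≃ₗ[LaurentPolynomial ℤ]
    (LaurentPolynomial ℤ ⧸ Ideal.span {Δ}))

end Alexander

/-! ## (1,1) knots in the three-sphere -/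

/-- The three-sphere. -/
abbrev Sphere3 := Metric.sphere (0 : EuclideanSpace ℝ (Fin 4)) 1

/-- The closed unit disk. -/
abbrev Disk := Metric.closedBall (0 : ℂ) 1

/-- `H` is a solid torus in the three-sphere with boundary torus `B`. -/
def IsSolidTorus (H B : Set Sphere3) : Prop :=
  ∃ e : Disk × Circle → Sphere3, Topology.IsEmbedding e ∧ Set.range e = H ∧
    e '' {q | ‖(q.1 : ℂ)‖ = 1} = B

/-- The three-sphere is the union of the solid tori `H₁` and `H₂`, which meet exactly in their
common boundary torus. -/
def IsGenusOneSplitting (H₁ H₂ : Set Sphere3) : Prop :=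
  H₁ ∪ H₂ = Set.univ ∧ IsSolidTorus H₁ (H₁ ∩ H₂) ∧ IsSolidTorus H₂ (H₁ ∩ H₂)

/-- `γ` is a trivial properly embedded arc in `H`, where `B` is the boundary of `H`: there is an
embedded disk `D` in `H` (the image of `f`) such that `γ` is an arc in `∂D` (the image of the
upper half circle) and `∂D ∩ ∂H` is `∂D` without the interior of `γ`. -/
def IsTrivialArc (γ H B : Set Sphere3) : Prop :=
  ∃ f : Disk → Sphere3, Topology.IsEmbedding f ∧ Set.range f ⊆ H ∧
    γ = f '' {q | ‖(q : ℂ)‖ = 1 ∧ 0 ≤ (q : ℂ).im} ∧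
    ∀ q : Disk, ‖(q : ℂ)‖ = 1 → (f q ∈ B ↔ (q : ℂ).im ≤ 0)

/-- A (tame) knot: a locally flat embedded circle in the three-sphere. -/
def IsKnot (K : Set Sphere3) : Prop :=
  (∃ f : Circle → Sphere3, Topology.IsEmbedding f ∧ Set.range f = K) ∧
  ∀ x ∈ K, ∃ c : OpenPartialHomeomorph Sphere3 (EuclideanSpace ℝ (Fin 3)),
    x ∈ c.source ∧ ∀ y ∈ c.source, y ∈ K ↔ c y 1 = 0 ∧ c y 2 = 0

/-- A (1,1) knot in the three-sphere. -/
def IsOneOneKnot (K : Set Sphere3) : Prop :=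
  IsKnot K ∧ ∃ H₁ H₂ : Set Sphere3, IsGenusOneSplitting H₁ H₂ ∧
    IsTrivialArc (K ∩ H₁) H₁ (H₁ ∩ H₂) ∧ IsTrivialArc (K ∩ H₂) H₂ (H₁ ∩ H₂)

end OneOneKnot

end

/-!
The group `G = ⟨X, Y | R⟩` with `φ(R) = 1` has infinite cyclic abelianization, generated by the class
of `Y`, in which `X` is the power `-(exponent sum of Y in R)` of this class.  Its Alexander module is
`ℤ[t, t⁻¹] / (∂R/∂X)` (`isAlexanderPolynomial_foxDeriv`): the class of a commutator is the Fox
derivative of a word for it, applied to one generator, by a crossed homomorphism on `G`; and the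
affine action of `G` on `ℤ[t, t⁻¹] / (∂R/∂X)` shows that there are no other relations.  The terms of
`∂R/∂X` are, up to sign, powers of `t`, one for each `X`-letter of `R` (`foxDeriv_self`).  The sign is
that of the letter and the exponent is `foxGrading`.  So it has to be shown that the gradings exist,
that they are unique up to constants, that `F` is `foxGrading` up to a constant, and that `(-1)^M` is
the sign of the letter up to a common sign.

Existence and uniqueness come from the shape of the graph of primitive disk words.  Read the periodic
word `R R R ...` as a walk on the integers, `φ` of the initial subwords.  It rises by one in each
period, so each `X`-letter of `R` has exactly one lift to a step between two fixed adjacent integers,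
if these are large enough.  The primitive disk words of `R` run exactly between consecutive such
steps (`Connects.consecutive`, `exists_connects`).  Hence the generators, ordered by their lifts, form
a chain, and the differences along a chain can be prescribed arbitrarily and determine a function up
to a constant (`exists_potential`, `exists_add_const`).

The differences of `F` are computed by `basepoints_sub`: `n_z(W) - n_w(W)` is the exponent sum of `Y`
in `W`, which is also the difference of `foxGrading` between the ends of `W`.  The recursion for
`P(W)` cuts `W` at its `X`-letters of height one into primitive disk words; the exponent sums of the
pieces telescope, up to the first and the last gap of `W`, and the difference of these two is that of
the components of `P(S)`.  The ends of a primitive disk word are letters of opposite signs, and `M`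
changes by an odd number, which gives the claim on `(-1)^M`.
-/

namespace OneOneKnot

/-! ### Exponent sums -/

@[simp] theorem expSum_nil (g : Fin 2) : expSum g [] = 0 := rfl

@[simp] theorem expSum_append (g : Fin 2) (U V : List Letter) :
    expSum g (U ++ V) = expSum g U + expSum g V := by
  simp only [expSum, List.count_append]
  push_cast
  ring

theorem expSum_cons (g : Fin 2) (a : Letter) (V : List Letter) :
    expSum g (a :: V) = expSum g [a] + expSum g V :=
  expSum_append g [a] V

theorem expSum_singleton (g : Fin 2) (a : Letter) :
    expSum g [a] = if a.1 = g then (if a.2 then 1 else -1) else 0 := by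
  revert g a
  decide

theorem expSum_replicate (g : Fin 2) (n : ℕ) (a : Letter) :
    expSum g (List.replicate n a) = n * expSum g [a] := by
  induction n with
  | zero => simp
  | succ n ih => rw [List.replicate_succ, expSum_cons, ih]; push_cast; ring

@[simp] theorem expSum_one_yPow (k : ℤ) : expSum 1 (yPow k) = k := by
  rw [yPow, expSum_replicate, expSum_singleton]
  rcases le_or_gt 0 k with h | h
  · simp [h]
  · simp [not_le.2 h, abs_of_neg h]

theorem expSum_take_succ (g : Fin 2) (W : List Letter) {i : ℕ} (h : i < W.length) :
    expSum g (W.take (i + 1)) = expSum g (W.take i) + expSum g [W[i]] := by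
  rw [List.take_succ_eq_append_getElem h, expSum_append]

theorem expSum_take_drop (g : Fin 2) (W : List Letter) (i k : ℕ) :
    expSum g ((W.drop i).take k) = expSum g (W.take (i + k)) - expSum g (W.take i) := by
  rw [List.take_add, expSum_append]
  ring

theorem expSum_drop (g : Fin 2) (W : List Letter) (i : ℕ) :
    expSum g (W.drop i) = expSum g W - expSum g (W.take i) := by
  conv_rhs => rw [← List.take_append_drop i W, expSum_append]
  simp

theorem phi_singleton_eq_one {a : Letter} : phi [a] = 1 ↔ a = lX := by
  revert a; decide

theorem phi_singleton_eq_neg_one {a : Letter} : phi [a] = -1 ↔ a = lX' := by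
  revert a; decide

theorem phi_singleton_eq_zero {a : Letter} : phi [a] = 0 ↔ a.1 = 1 := by
  revert a; decide

theorem abs_phi_singleton_le (a : Letter) : |phi [a]| ≤ 1 := by
  revert a; decide

theorem xCount_append (U V : List Letter) : xCount (U ++ V) = xCount U + xCount V := by
  simp only [xCount, List.count_append]
  ring

theorem fst_eq_one_of_xCount_eq_zero {U : List Letter} (h : xCount U = 0) :
    ∀ a ∈ U, a.1 = 1 := by
  simp only [xCount, Nat.add_eq_zero_iff, List.count_eq_zero] at h
  intro a ha
  by_contra h1
  have : a = lX ∨ a = lX' := by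
    clear ha
    revert a
    decide
  rcases this with rfl | rfl
  exacts [h.1 ha, h.2 ha]

theorem xCount_eq_zero {U : List Letter} (h : ∀ a ∈ U, a.1 = 1) : xCount U = 0 := by
  simp only [xCount, Nat.add_eq_zero_iff, List.count_eq_zero]
  exact ⟨fun h' => by simpa using h _ h', fun h' => by simpa using h _ h'⟩

/-- A reduced word in `Y` and its inverse is a power of `Y`. -/
theorem eq_yPow_of_isReduced {U : List Letter} (hU : FreeGroup.IsReduced U)
    (h : ∀ a ∈ U, a.1 = 1) : U = yPow (expSum 1 U) := by
  have key : ∃ n b, U = List.replicate n ((1, b) : Letter) := by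
    induction U with
    | nil => exact ⟨0, true, rfl⟩
    | cons a U ih =>
      obtain ⟨n, b, rfl⟩ := ih (hU.infix (List.suffix_cons a U).isInfix)
        fun x hx => h x (List.mem_cons_of_mem _ hx)
      obtain ⟨a1, a2⟩ := a
      obtain rfl : a1 = 1 := h _ List.mem_cons_self
      cases n with
      | zero => exact ⟨1, a2, rfl⟩
      | succ n =>
        rw [List.replicate_succ, FreeGroup.isReduced_cons_cons] at hU
        obtain rfl : a2 = b := hU.1 rfl
        exact ⟨n + 2, a2, rfl⟩
  obtain ⟨n, b, rfl⟩ := key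
  rw [expSum_replicate, expSum_singleton, yPow]
  rcases Nat.eq_zero_or_pos n with rfl | hn
  · simp
  · cases b
    · simp [hn.ne']
    · simp

/-! ### Walks on the integers and their crossings -/

/-- A walk on the integers whose steps are `-1`, `0` or `1`. -/
def IsWalk (h : ℕ → ℤ) : Prop := ∀ i, |h (i + 1) - h i| ≤ 1

/-- The walk `h` passes between `c` and `c + 1`, in either direction, in its step number `i`. -/
def Crosses (h : ℕ → ℤ) (c : ℤ) (i : ℕ) : Prop :=
  (h i = c ∧ h (i + 1) = c + 1) ∨ (h i = c + 1 ∧ h (i + 1) = c)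

theorem IsWalk.above {h : ℕ → ℤ} (hh : IsWalk h) {c : ℤ} {i j : ℕ} (hi : h (i + 1) = c + 1)
    (hn : ∀ m, i < m → m < j → ¬ Crosses h c m) (m : ℕ) (him : i < m) (hmj : m ≤ j) :
    c + 1 ≤ h m := by
  induction m, him using Nat.le_induction with
  | base => exact hi.ge
  | succ m him ih =>
    have h1 := ih (by omega)
    have h2 := hn m him (by omega)
    have h3 := abs_le.1 (hh m)
    unfold Crosses at h2
    omega

theorem IsWalk.below {h : ℕ → ℤ} (hh : IsWalk h) {c : ℤ} {i j : ℕ} (hi : h (i + 1) = c)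
    (hn : ∀ m, i < m → m < j → ¬ Crosses h c m) (m : ℕ) (him : i < m) (hmj : m ≤ j) :
    h m ≤ c := by
  induction m, him using Nat.le_induction with
  | base => exact hi.le
  | succ m him ih =>
    have h1 := ih (by omega)
    have h2 := hn m him (by omega)
    have h3 := abs_le.1 (hh m)
    unfold Crosses at h2
    omega

/-- The word `U` describes the steps of the walk `h` from time `i` on. -/
def Follows (U : List Letter) (h : ℕ → ℤ) (i : ℕ) : Prop :=
  ∀ k ≤ U.length, phi (U.take k) = h (i + k) - h i

theorem Follows.phi_getElem {U : List Letter} {h : ℕ → ℤ} {i : ℕ} (hU : Follows U h i) {k : ℕ}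
    (hk : k < U.length) : phi [U[k]] = h (i + k + 1) - h (i + k) := by
  have h1 := hU k hk.le
  have h2 := hU (k + 1) hk
  have h3 := expSum_take_succ 0 U hk
  simp only [phi] at *
  rw [← add_assoc] at h2
  omega

/-- The word that a walk spells between two consecutive crossings of the same height is a primitive
disk word. -/
theorem isPrimitiveDiskWord_of_crosses {U : List Letter} {h : ℕ → ℤ} (hh : IsWalk h) {c : ℤ}
    {i j : ℕ} (hij : i < j) (hi : Crosses h c i) (hj : Crosses h c j)
    (hn : ∀ m, i < m → m < j → ¬ Crosses h c m) (hU : Follows U h i)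
    (hlen : U.length = j + 1 - i) : IsPrimitiveDiskWord U := by
  have h0 := hU.phi_getElem (k := 0) (by omega)
  have h1 := hU.phi_getElem (k := U.length - 1) (by omega)
  have hfull := hU U.length le_rfl
  rw [List.take_length] at hfull
  rw [show i + (U.length - 1) = j by omega] at h1
  rw [show i + U.length = j + 1 by omega] at hfull
  have hhead : U.head? = some U[0] := by
    rw [List.head?_eq_getElem?, List.getElem?_eq_getElem]
  have hlast : U.getLast? = some (U[U.length - 1]'(by omega)) := by
    rw [List.getLast?_eq_getElem?, List.getElem?_eq_getElem]
  simp only [add_zero] at h0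
  rw [IsPrimitiveDiskWord, IsDiskWord, hhead, hlast]
  rcases hi with hi | hi
  · have hab := hh.above hi.2 hn
    have hj' := hab j hij le_rfl
    obtain ⟨hj1, hj2⟩ : h j = c + 1 ∧ h (j + 1) = c := by unfold Crosses at hj; omega
    rw [phi_singleton_eq_one.1 (by omega : phi [U[0]] = 1),
      phi_singleton_eq_neg_one.1 (by omega : phi [U[U.length - 1]] = -1)]
    refine ⟨⟨Or.inl ⟨rfl, rfl⟩, by omega⟩, fun k hk hk' => ?_⟩
    have := hU k hk'.le
    have := hab (i + k) (by omega) (by omega)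
    omega
  · have hab := hh.below hi.2 hn
    have hj' := hab j hij le_rfl
    obtain ⟨hj1, hj2⟩ : h j = c ∧ h (j + 1) = c + 1 := by unfold Crosses at hj; omega
    rw [phi_singleton_eq_neg_one.1 (by omega : phi [U[0]] = -1),
      phi_singleton_eq_one.1 (by omega : phi [U[U.length - 1]] = 1)]
    refine ⟨⟨Or.inr ⟨rfl, rfl⟩, by omega⟩, fun k hk hk' => ?_⟩
    have := hU k hk'.le
    have := hab (i + k) (by omega) (by omega)
    omega

theorem IsPrimitiveDiskWord.two_le_length {U : List Letter} (hU : IsPrimitiveDiskWord U) :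
    2 ≤ U.length := by
  obtain ⟨⟨h, -⟩, -⟩ := hU
  match U with
  | [] => simp at h
  | [a] => rcases h with ⟨h1, h2⟩ | ⟨h1, h2⟩ <;> simp at h1 h2 <;> simp [h1] at h2
  | a :: b :: U => simp

/-- Conversely, the ends of a primitive disk word are consecutive crossings of the same height. -/
theorem IsPrimitiveDiskWord.crosses {U : List Letter} {h : ℕ → ℤ} (hh : IsWalk h) {i : ℕ}
    (hP : IsPrimitiveDiskWord U) (hU : Follows U h i) :
    ∃ c, Crosses h c i ∧ Crosses h c (i + U.length - 1) ∧
      ∀ m, i < m → m < i + U.length - 1 → ¬ Crosses h c m := by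
  have h2 := hP.two_le_length
  obtain ⟨⟨hends, h0⟩, hne⟩ := hP
  have e0 := hU.phi_getElem (k := 0) (by omega)
  have e1 := hU.phi_getElem (k := U.length - 1) (by omega)
  have hfull := hU U.length le_rfl
  rw [List.take_length] at hfull
  have hhead : U.head? = some U[0] := by
    rw [List.head?_eq_getElem?, List.getElem?_eq_getElem]
  have hlast : U.getLast? = some (U[U.length - 1]'(by omega)) := by
    rw [List.getLast?_eq_getElem?, List.getElem?_eq_getElem]
  rw [hhead, hlast] at hends
  simp only [Option.some.injEq] at hends
  have hne' : ∀ m, i < m → m < i + U.length → h m ≠ h i := by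
    intro m h1 h2 h3
    apply hne (m - i) (by omega) (by omega)
    rw [hU _ (by omega), show i + (m - i) = m by omega, h3, sub_self]
  simp only [add_zero] at e0
  rw [show i + (U.length - 1) = i + U.length - 1 by omega,
    show i + U.length - 1 + 1 = i + U.length by omega] at e1
  rcases hends with ⟨ha, hb⟩ | ⟨ha, hb⟩
  · rw [phi_singleton_eq_one.2 ha] at e0
    rw [phi_singleton_eq_neg_one.2 hb] at e1
    have hge : ∀ m, i + 1 ≤ m → m < i + U.length → h i + 1 ≤ h m := by
      intro m hm
      induction m, hm using Nat.le_induction with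
      | base => intro _; omega
      | succ m hm ih =>
        intro hlt
        have := ih (by omega)
        have := abs_le.1 (hh m)
        have := hne' (m + 1) (by omega) hlt
        omega
    refine ⟨h i, Or.inl ⟨rfl, by omega⟩, Or.inr ⟨by omega, ?_⟩, fun m h3 h4 h5 => ?_⟩
    · rw [show i + U.length - 1 + 1 = i + U.length by omega]; omega
    · have := hge m h3 (by omega)
      have := hge (m + 1) (by omega) (by omega)
      unfold Crosses at h5
      omega
  · rw [phi_singleton_eq_neg_one.2 ha] at e0
    rw [phi_singleton_eq_one.2 hb] at e1
    have hge : ∀ m, i + 1 ≤ m → m < i + U.length → h m ≤ h i - 1 := by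
      intro m hm
      induction m, hm using Nat.le_induction with
      | base => intro _; omega
      | succ m hm ih =>
        intro hlt
        have := ih (by omega)
        have := abs_le.1 (hh m)
        have := hne' (m + 1) (by omega) hlt
        omega
    refine ⟨h i - 1, Or.inr ⟨by omega, by omega⟩, Or.inl ⟨by omega, ?_⟩, fun m h3 h4 h5 => ?_⟩
    · rw [show i + U.length - 1 + 1 = i + U.length by omega]; omega
    · have := hge m h3 (by omega)
      have := hge (m + 1) (by omega) (by omega)
      unfold Crosses at h5
      omega

/-! ### Base points of primitive disk words -/

/-- `X Y^l X` or `X⁻¹ Y^(-l) X⁻¹` is a subword of the word `W`, which is not read cyclically. -/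
def HasLinearGap (W : List Letter) (l : ℤ) : Prop :=
  lX :: (yPow l ++ [lX]) <:+: W ∨ lX' :: (yPow (-l) ++ [lX']) <:+: W

/-- The conditions on a quasi-geometric relator, except for `φ = 1`, imposed on a word that is not
read cyclically.  In contrast to the subwords of a fixed relator, these words are closed under
inversion of all letters `X` or of all letters `Y`. -/
structure IsQuasiGeometricWord (W : List Letter) : Prop where
  isReduced : FreeGroup.IsReduced W
  turn_up : ∀ k : ℤ, lX :: (yPow k ++ [lX']) <:+: W → |k| = 1
  turn_down : ∀ k : ℤ, lX' :: (yPow k ++ [lX]) <:+: W → |k| = 1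
  gap : ∀ l l' : ℤ, HasLinearGap W l → HasLinearGap W l' → |l - l'| ≤ 1

theorem IsQuasiGeometricWord.infix {U W : List Letter} (hW : IsQuasiGeometricWord W)
    (h : U <:+: W) : IsQuasiGeometricWord U where
  isReduced := hW.isReduced.infix h
  turn_up k hk := hW.turn_up k (hk.trans h)
  turn_down k hk := hW.turn_down k (hk.trans h)
  gap l l' hl hl' := hW.gap l l' (hl.imp (·.trans h) (·.trans h)) (hl'.imp (·.trans h) (·.trans h))

@[simp] theorem invertGen_append (g : Fin 2) (U V : List Letter) :
    invertGen g (U ++ V) = invertGen g U ++ invertGen g V := List.map_append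

@[simp] theorem invertGen_cons (g : Fin 2) (a : Letter) (V : List Letter) :
    invertGen g (a :: V) = (if a.1 = g then (a.1, !a.2) else a) :: invertGen g V := rfl

@[simp] theorem invertGen_nil (g : Fin 2) : invertGen g [] = [] := rfl

@[simp] theorem length_invertGen (g : Fin 2) (W : List Letter) :
    (invertGen g W).length = W.length := List.length_map _

@[simp] theorem invertGen_invertGen (g : Fin 2) (W : List Letter) :
    invertGen g (invertGen g W) = W := by
  induction W with
  | nil => rfl
  | cons a W ih =>
    rw [invertGen_cons, invertGen_cons, ih]
    congr 1
    clear ih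
    revert g a
    decide

theorem invertGen_zero_yPow (k : ℤ) : invertGen 0 (yPow k) = yPow k := by
  simp [invertGen, yPow]

theorem invertGen_one_yPow (k : ℤ) : invertGen 1 (yPow k) = yPow (-k) := by
  rcases lt_trichotomy k 0 with h | rfl | h
  · simp [invertGen, yPow, h.not_ge, h.le]
  · simp [invertGen, yPow]
  · simp [invertGen, yPow, h.not_ge, h.le]

theorem infix_invertGen {g : Fin 2} {U W : List Letter} :
    U <:+: invertGen g W ↔ invertGen g U <:+: W := by
  constructor
  · intro h
    rw [← invertGen_invertGen g W]
    exact h.map _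
  · intro h
    rw [← invertGen_invertGen g U]
    exact h.map _

theorem IsReduced.invertGen {W : List Letter} (hW : FreeGroup.IsReduced W) (g : Fin 2) :
    FreeGroup.IsReduced (invertGen g W) := by
  rw [FreeGroup.IsReduced] at *
  rw [OneOneKnot.invertGen, List.isChain_map]
  refine hW.imp ?_
  revert g
  decide

theorem expSum_invertGen (g g' : Fin 2) (W : List Letter) :
    expSum g (invertGen g' W) = if g = g' then -expSum g W else expSum g W := by
  induction W with
  | nil => simp
  | cons a W ih =>
    rw [invertGen_cons, expSum_cons, ih, expSum_cons g a]
    have : expSum g [if a.1 = g' then (a.1, !a.2) else a] =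
        if g = g' then -expSum g [a] else expSum g [a] := by
      clear ih
      revert g g' a
      decide
    rw [this]
    split_ifs <;> ring

theorem xCount_invertGen (g : Fin 2) (W : List Letter) : xCount (invertGen g W) = xCount W := by
  induction W with
  | nil => rfl
  | cons a W ih =>
    rw [invertGen_cons, ← List.singleton_append, xCount_append, ih,
      ← List.singleton_append (x := a), xCount_append]
    congr 1
    clear ih
    revert g a
    decide

theorem IsQuasiGeometricWord.invertGen {W : List Letter} (hW : IsQuasiGeometricWord W)
    (g : Fin 2) : IsQuasiGeometricWord (invertGen g W) := by
  have hg : g = 0 ∨ g = 1 := by revert g; decide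
  refine ⟨IsReduced.invertGen hW.isReduced g, ?_, ?_, ?_⟩
  · intro k hk
    rw [infix_invertGen] at hk
    rcases hg with rfl | rfl
    · exact hW.turn_down k (by simpa [invertGen_zero_yPow] using hk)
    · simpa using hW.turn_up (-k) (by simpa [invertGen_one_yPow] using hk)
  · intro k hk
    rw [infix_invertGen] at hk
    rcases hg with rfl | rfl
    · exact hW.turn_up k (by simpa [invertGen_zero_yPow] using hk)
    · simpa using hW.turn_down (-k) (by simpa [invertGen_one_yPow] using hk)
  · have key : ∀ l, HasLinearGap (OneOneKnot.invertGen g W) l → HasLinearGap W (-l) := by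
      intro l hl
      rw [HasLinearGap, infix_invertGen, infix_invertGen] at hl
      rcases hg with rfl | rfl
      · exact hl.symm.imp (by simp [invertGen_zero_yPow]) (by simp [invertGen_zero_yPow])
      · exact hl.imp (by simp [invertGen_one_yPow]) (by simp [invertGen_one_yPow])
    intro l l' hl hl'
    have := hW.gap _ _ (key l' hl') (key l hl)
    rwa [neg_sub_neg] at this

theorem IsPrimitiveDiskWord.invertGen {W : List Letter} (hW : IsPrimitiveDiskWord W)
    (g : Fin 2) : IsPrimitiveDiskWord (invertGen g W) := by
  have hg : g = 0 ∨ g = 1 := by revert g; decide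
  obtain ⟨⟨h1, h2⟩, h3⟩ := hW
  refine ⟨⟨?_, ?_⟩, ?_⟩
  · rw [OneOneKnot.invertGen, List.head?_map, List.getLast?_map]
    rcases hg with rfl | rfl
    · refine h1.symm.imp ?_ ?_ <;> rintro ⟨e1, e2⟩ <;> simp [e1, e2]
    · refine h1.imp ?_ ?_ <;> rintro ⟨e1, e2⟩ <;> simp [e1, e2]
  · rw [phi, expSum_invertGen, show expSum 0 W = 0 from h2]
    simp
  · intro k hk hk'
    rw [length_invertGen] at hk'
    have := h3 k hk hk'
    rw [phi] at this
    rw [OneOneKnot.invertGen, ← List.map_take, phi, ← OneOneKnot.invertGen, expSum_invertGen]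
    split_ifs <;> simpa using this

theorem isUpward_or {W : List Letter} (hW : IsPrimitiveDiskWord W) :
    IsUpward W ∨ W.head? = some lX' := hW.1.1.imp (·.1) (·.1)

theorem isUpward_toUpwardPositive {W : List Letter} (hW : IsPrimitiveDiskWord W) :
    IsUpward (toUpwardPositive W) := by
  unfold toUpwardPositive
  by_cases h : IsUpward W
  · have h' := h
    rw [IsUpward] at h'
    split_ifs
    · exact h
    · simp [IsUpward, invertGen, h']
  · have h' := (isUpward_or hW).resolve_left h
    split_ifs <;> simp [IsUpward, invertGen, h']

theorem IsPrimitiveDiskWord.toUpwardPositive {W : List Letter} (hW : IsPrimitiveDiskWord W) :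
    IsPrimitiveDiskWord (toUpwardPositive W) := by
  unfold OneOneKnot.toUpwardPositive
  split_ifs
  exacts [hW, hW.invertGen 1, (hW.invertGen 1).invertGen 0, hW.invertGen 0]

theorem IsQuasiGeometricWord.toUpwardPositive {W : List Letter} (hW : IsQuasiGeometricWord W) :
    IsQuasiGeometricWord (toUpwardPositive W) := by
  unfold OneOneKnot.toUpwardPositive
  split_ifs
  exacts [hW, hW.invertGen 1, (hW.invertGen 1).invertGen 0, hW.invertGen 0]

theorem xCount_toUpwardPositive (W : List Letter) : xCount (toUpwardPositive W) = xCount W := by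
  unfold toUpwardPositive
  split_ifs <;> simp only [xCount_invertGen]

/-- The symmetries that reduce to the upward positive case preserve the property
`n_z - n_w = (exponent sum of Y)`. -/
theorem fromUpwardPositive_sub {W : List Letter} {q : ℤ × ℤ}
    (h : q.1 - q.2 = expSum 1 (toUpwardPositive W)) :
    (fromUpwardPositive W q).1 - (fromUpwardPositive W q).2 = expSum 1 W := by
  unfold toUpwardPositive at h
  unfold fromUpwardPositive
  have h10 : ¬ (1 : Fin 2) = 0 := by decide
  split_ifs at h ⊢ <;> (try simp only [expSum_invertGen, if_neg h10, if_true] at h) <;>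
    (try simp only) <;> omega

/-- The values of `φ` on the initial subwords of `W`. -/
def level (W : List Letter) (i : ℕ) : ℤ := phi (W.take i)

@[simp] theorem level_zero (W : List Letter) : level W 0 = 0 := by simp [level]

theorem level_succ {W : List Letter} {i : ℕ} (h : i < W.length) :
    level W (i + 1) = level W i + phi [W[i]] := expSum_take_succ 0 W h

theorem isWalk_level (W : List Letter) : IsWalk (level W) := by
  intro i
  by_cases h : i < W.length
  · rw [level_succ h, add_sub_cancel_left]
    exact abs_phi_singleton_le _
  · rw [level, level, List.take_of_length_le (by omega), List.take_of_length_le (by omega)]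
    simp

theorem follows_drop_take (W : List Letter) (i k : ℕ) :
    Follows ((W.drop i).take k) (level W) i := by
  intro m hm
  rw [List.take_take, level, level, phi, expSum_take_drop]
  rw [List.length_take, List.length_drop] at hm
  rcases le_total m k with h | h
  · rw [min_eq_left h]
  · have : m = k := by omega
    rw [this, min_self]

theorem crosses_level_iff {W : List Letter} {c : ℤ} {i : ℕ} :
    Crosses (level W) c i ↔
      i < W.length ∧ (W[i]? = some lX ∨ W[i]? = some lX') ∧ height W i = c := by
  by_cases h : i < W.length
  · have h1 := level_succ h
    have h2 : height W i = level W (i + 1) - (if W[i]? = some lX then 1 else 0) := rfl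
    rw [List.getElem?_eq_getElem h] at h2 ⊢
    simp only [Option.some.injEq] at h2 ⊢
    rw [h2, Crosses]
    by_cases e : W[i] = lX
    · rw [phi_singleton_eq_one.2 e] at h1
      rw [if_pos e]
      constructor
      · intro h3
        exact ⟨h, Or.inl e, by omega⟩
      · rintro ⟨-, -, h3⟩
        omega
    · rw [if_neg e]
      by_cases e' : W[i] = lX'
      · rw [phi_singleton_eq_neg_one.2 e'] at h1
        constructor
        · intro h3
          exact ⟨h, Or.inr e', by omega⟩
        · rintro ⟨-, -, h3⟩
          omega
      · refine iff_of_false ?_ (by tauto)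
        have := phi_singleton_eq_one.not.2 e
        have := phi_singleton_eq_neg_one.not.2 e'
        omega
  · refine iff_of_false ?_ (by tauto)
    rw [Crosses, level, level, List.take_of_length_le (by omega),
      List.take_of_length_le (by omega)]
    omega

theorem mem_heightOne {W : List Letter} {i : ℕ} :
    i ∈ heightOne W ↔ Crosses (level W) 1 i := by
  rw [crosses_level_iff, heightOne, List.mem_filter, List.mem_range, decide_eq_true_eq]

theorem pairwise_heightOne (W : List Letter) : (heightOne W).Pairwise (· < ·) :=
  List.Pairwise.filter _ List.pairwise_lt_range

theorem consecutive_of_mem_zip_tail {L : List ℕ} (hL : L.Pairwise (· < ·)) {p : ℕ × ℕ}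
    (hp : p ∈ L.zip L.tail) :
    p.1 ∈ L ∧ p.2 ∈ L ∧ p.1 < p.2 ∧ ∀ m ∈ L, ¬ (p.1 < m ∧ m < p.2) := by
  induction L with
  | nil => simp at hp
  | cons a L ih =>
    rw [List.tail_cons] at hp
    cases L with
    | nil => simp at hp
    | cons b L =>
      rw [List.zip_cons_cons, List.mem_cons] at hp
      rw [List.pairwise_cons] at hL
      rcases hp with rfl | hp
      · refine ⟨by simp, by simp, hL.1 b (by simp), ?_⟩
        have hb := (List.pairwise_cons.1 hL.2).1
        intro m hm
        simp only [List.mem_cons] at hm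
        rcases hm with rfl | rfl | hm
        · simp
        · simp
        · have := hb m hm
          simp only
          omega
      · obtain ⟨h1, h2, h3, h4⟩ := ih hL.2 hp
        refine ⟨List.mem_cons_of_mem _ h1, List.mem_cons_of_mem _ h2, h3, ?_⟩
        intro m hm
        rcases List.mem_cons.1 hm with rfl | hm
        · have := hL.1 _ h1
          omega
        · exact h4 m hm

theorem sum_zip_tail (f : ℕ → ℤ) (L : List ℕ) (hL : L ≠ []) :
    ((L.zip L.tail).map fun p => f p.2 - f p.1).sum = f (L.getLastD 0) - f (L.headD 0) := by
  induction L with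
  | nil => exact absurd rfl hL
  | cons a L ih =>
    cases L with
    | nil => simp
    | cons b L =>
      have := ih (by simp)
      simp only [List.tail_cons, List.zip_cons_cons, List.map_cons, List.sum_cons,
        List.headD_cons] at this ⊢
      rw [this]
      simp

theorem infix_of_mem_pieces {U W : List Letter} (hU : U ∈ pieces W) : U <:+: W := by
  simp only [pieces, List.mem_map] at hU
  obtain ⟨p, -, rfl⟩ := hU
  exact (List.take_prefix _ _).isInfix.trans (List.drop_suffix _ _).isInfix

theorem isPrimitiveDiskWord_of_mem_pieces {U W : List Letter} (hU : U ∈ pieces W) :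
    IsPrimitiveDiskWord U := by
  simp only [pieces, List.mem_map] at hU
  obtain ⟨p, hp, rfl⟩ := hU
  obtain ⟨h1, h2, h3, h4⟩ := consecutive_of_mem_zip_tail (pairwise_heightOne W) hp
  have hlt := (pos_of_mem_heightOne h2).2
  rw [mem_heightOne] at h1 h2
  refine isPrimitiveDiskWord_of_crosses (isWalk_level W) h3 h1 h2
    (fun m hm hm' hc => h4 m (mem_heightOne.2 hc) ⟨hm, hm'⟩) (follows_drop_take W _ _) ?_
  rw [List.length_take, List.length_drop]
  omega

/-- The exponent sums of `Y` in the pieces telescope. -/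
theorem sum_expSum_pieces {W : List Letter} (hW : heightOne W ≠ []) :
    ((pieces W).map (expSum 1)).sum =
      expSum 1 (W.take ((heightOne W).getLastD 0)) -
        expSum 1 (W.take ((heightOne W).headD 0)) := by
  rw [← sum_zip_tail (fun i => expSum 1 (W.take i)) _ hW, pieces, List.map_map]
  congr 1
  refine List.map_congr_left fun p hp => ?_
  obtain ⟨h1, h2, h3, h4⟩ := consecutive_of_mem_zip_tail (pairwise_heightOne W) hp
  have hlt := (pos_of_mem_heightOne h2).2
  rw [mem_heightOne, crosses_level_iff, List.getElem?_eq_getElem hlt] at h2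
  have h0 : expSum 1 [W[p.2]] = 0 := by
    rcases h2.2.1 with h | h <;> rw [Option.some.inj h] <;> rfl
  simp only [Function.comp_apply]
  rw [expSum_take_drop, show p.1 + (p.2 + 1 - p.1) = p.2 + 1 by omega, expSum_take_succ _ _ hlt,
    h0, add_zero]

/-- `P(S)` has difference `l - l'`, whatever the case distinction in its definition. -/
theorem squareCount_sub {W : List Letter} {l l' : ℤ}
    (hl : expSum 1 (W.take ((heightOne W).headD 0)) = l)
    (hl' : -expSum 1 (W.drop ((heightOne W).getLastD 0)) = l') (h : |l - l'| ≤ 1) :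
    (squareCount W).1 - (squareCount W).2 = l - l' := by
  unfold squareCount
  simp only [hl, hl']
  have := abs_le.1 h
  split_ifs <;> simp <;> omega

/-- A stretch of a reduced word between two `X`-letters, with no other `X`-letter in between. -/
theorem stretch_eq {W : List Letter} (hW : FreeGroup.IsReduced W) {i j : ℕ} (hij : i < j)
    (hj : j < W.length) (hY : ∀ m (h : m < W.length), i < m → m < j → (W[m]).1 = 1) :
    (W.drop i).take (j + 1 - i) =
      W[i] :: (yPow (expSum 1 ((W.drop (i + 1)).take (j - (i + 1)))) ++ [W[j]]) := by
  set M := (W.drop (i + 1)).take (j - (i + 1)) with hM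
  have hMi : M <:+: W :=
    (List.take_prefix _ _).isInfix.trans (List.drop_suffix _ _).isInfix
  have hMY : ∀ a ∈ M, a.1 = 1 := by
    intro a ha
    obtain ⟨n, hn, rfl⟩ := List.getElem_of_mem ha
    rw [hM, List.length_take, List.length_drop] at hn
    simp only [hM, List.getElem_take, List.getElem_drop]
    exact hY _ _ (by omega) (by omega)
  rw [← eq_yPow_of_isReduced (hW.infix hMi) hMY, List.drop_eq_getElem_cons (by omega),
    show j + 1 - i = (j - (i + 1) + 1) + 1 by omega, List.take_succ_cons,
    List.take_succ_eq_append_getElem (by rw [List.length_drop]; omega)]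
  congr 3
  rw [List.getElem_drop]
  congr 1
  omega

section Upward

variable {V : List Letter}

theorem level_pos (hV : IsPrimitiveDiskWord V) (hup : IsUpward V) {m : ℕ} (h0 : 0 < m)
    (hm : m < V.length) : 1 ≤ level V m := by
  have h1 : level V 1 = 1 := by
    have hlen : 0 < V.length := by omega
    have : V[0] = lX := by
      rw [IsUpward, List.head?_eq_getElem?, List.getElem?_eq_getElem hlen] at hup
      exact Option.some.inj hup
    have h := level_succ hlen
    rwa [phi_singleton_eq_one.2 this, level_zero] at h
  induction m, Nat.succ_le_iff.2 h0 using Nat.le_induction with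
  | base => exact h1.ge
  | succ m h0 ih =>
    have := ih (by omega) (by omega)
    have h2 : level V (m + 1) ≠ 0 := hV.2 (m + 1) (by omega) hm
    have := abs_le.1 (isWalk_level V m)
    omega

theorem level_one (hup : IsUpward V) : level V 1 = 1 := by
  match V, hup with
  | a :: V, hup =>
    rw [IsUpward, List.head?_cons, Option.some.injEq] at hup
    subst hup
    rfl

theorem getLast_eq (hV : IsPrimitiveDiskWord V) (hup : IsUpward V) :
    V.getLast? = some lX' := by
  rcases hV.1.1 with h | h
  · exact h.2
  · rw [IsUpward, h.1] at hup
    simp at hup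

theorem level_pred_length (hV : IsPrimitiveDiskWord V) (hup : IsUpward V) :
    level V (V.length - 1) = 1 := by
  have hlen := hV.two_le_length
  have h1 := level_succ (W := V) (i := V.length - 1) (by omega)
  have h2 : V[V.length - 1]'(by omega) = lX' := by
    have := getLast_eq hV hup
    rw [List.getLast?_eq_getElem?, List.getElem?_eq_getElem (by omega)] at this
    exact Option.some.inj this
  rw [phi_singleton_eq_neg_one.2 h2, show V.length - 1 + 1 = V.length by omega, level,
    List.take_length, hV.1.2] at h1
  omega

/-- Before its first crossing of height one the walk stays at level one: it can leave this level
downwards only at the end of the word. -/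
theorem level_eq_one_of_forall_lt (hV : IsPrimitiveDiskWord V) (hup : IsUpward V) {k : ℕ}
    (hk : k < V.length) (h : ∀ m < k, ¬ Crosses (level V) 1 m) {m : ℕ} (h0 : 0 < m)
    (hm : m ≤ k) : level V m = 1 := by
  induction m, Nat.succ_le_iff.2 h0 using Nat.le_induction with
  | base => exact level_one hup
  | succ m h0 ih =>
    have := ih (by omega) (by omega)
    have := level_pos hV hup (m := m + 1) (by omega) (by omega)
    have := abs_le.1 (isWalk_level V m)
    have := h m (by omega)
    unfold Crosses at this
    omega

/-- After its last crossing of height one the walk stays at level one, up to the last letter. -/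
theorem level_eq_one_of_forall_gt (hV : IsPrimitiveDiskWord V) (hup : IsUpward V) {k : ℕ}
    (h : ∀ m, k < m → ¬ Crosses (level V) 1 m) {m : ℕ} (h0 : k < m)
    (hm : m ≤ V.length - 1) : level V m = 1 := by
  induction hm using Nat.decreasingInduction with
  | self => exact level_pred_length hV hup
  | of_succ m hm ih =>
    have := ih (by omega)
    have := level_pos hV hup (m := m) (by omega) (by omega)
    have := abs_le.1 (isWalk_level V m)
    have := h m (by omega)
    unfold Crosses at this
    omega

theorem fst_eq_one_of_level_eq {W : List Letter} {m : ℕ} (hm : m < W.length)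
    (h : level W (m + 1) = level W m) : (W[m]).1 = 1 := by
  rw [level_succ hm] at h
  exact phi_singleton_eq_zero.1 (by omega)

theorem heightOne_ne_nil (hV : IsPrimitiveDiskWord V) (hup : IsUpward V) (hx : xCount V ≠ 2) :
    heightOne V ≠ [] := by
  intro hnil
  apply hx
  have hlen := hV.two_le_length
  have h1 : ∀ m, ¬ Crosses (level V) 1 m := fun m hm => by
    have := mem_heightOne.2 hm
    simp [hnil] at this
  have hlev : ∀ m, 0 < m → m < V.length → level V m = 1 := fun m h0 hm =>
    level_eq_one_of_forall_lt hV hup hm (fun m _ => h1 m) h0 le_rfl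
  have hY : ∀ a ∈ (V.drop 1).take (V.length - 2), a.1 = 1 := by
    intro a ha
    obtain ⟨n, hn, rfl⟩ := List.getElem_of_mem ha
    rw [List.length_take, List.length_drop] at hn
    simp only [List.getElem_take, List.getElem_drop]
    apply fst_eq_one_of_level_eq
    rw [hlev _ (by omega) (by omega), hlev _ (by omega) (by omega)]
  have hsplit : V = V.take 1 ++ (V.drop 1).take (V.length - 2) ++ V.drop (V.length - 1) := by
    rw [← List.take_add, show 1 + (V.length - 2) = V.length - 1 by omega, List.take_append_drop]
  have ht : V.take 1 = [lX] := by
    rw [IsUpward] at hup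
    cases V with
    | nil => simp at hup
    | cons a V => simpa using hup
  have hd : V.drop (V.length - 1) = [lX'] := by
    have := getLast_eq hV hup
    rw [List.getLast?_eq_getElem?, List.getElem?_eq_getElem (by omega), Option.some.injEq] at this
    rw [List.drop_eq_getElem_cons (by omega), this, List.drop_of_length_le (by omega)]
  rw [hsplit, xCount_append, xCount_append, xCount_eq_zero hY, ht, hd]
  rfl

/-- The first and the last gap of an upward primitive disk word differ by at most one: the `X`-letters
next to its ends are those of height one at the ends of the list `heightOne`, so that
`X Y^l X` and `X⁻¹ Y^(-l') X⁻¹` are subwords. -/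
theorem gap_ends (hV : IsPrimitiveDiskWord V) (hup : IsUpward V) (hx : xCount V ≠ 2)
    (hq : IsQuasiGeometricWord V) :
    |expSum 1 (V.take ((heightOne V).headD 0)) - -expSum 1 (V.drop ((heightOne V).getLastD 0))|
      ≤ 1 := by
  have hne := heightOne_ne_nil hV hup hx
  have hsort := pairwise_heightOne V
  have hV0 : ∀ h : 0 < V.length, V[0] = lX := by
    intro h
    rw [IsUpward, List.head?_eq_getElem?, List.getElem?_eq_getElem h] at hup
    exact Option.some.inj hup
  apply hq.gap
  · left
    set k := (heightOne V).headD 0 with hk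
    have hkmem : k ∈ heightOne V := by
      rw [hk, List.headD_eq_head?_getD, List.head?_eq_some_head hne]
      exact List.head_mem hne
    have hmin : ∀ m < k, ¬ Crosses (level V) 1 m := by
      intro m hm hc
      have hmem := mem_heightOne.2 hc
      obtain ⟨a, L, hL⟩ := List.exists_cons_of_ne_nil hne
      rw [hL] at hmem hsort
      rw [hL, List.headD_cons] at hk
      rcases List.mem_cons.1 hmem with h | h
      · omega
      · have := (List.pairwise_cons.1 hsort).1 m h
        omega
    obtain ⟨hk0, hklt⟩ := pos_of_mem_heightOne hkmem
    have hlev : ∀ m, 0 < m → m ≤ k → level V m = 1 := fun m =>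
      level_eq_one_of_forall_lt hV hup hklt hmin
    have hVk : V[k] = lX := by
      have h1 := level_succ hklt
      have h2 := hlev k hk0 le_rfl
      have h3 := mem_heightOne.1 hkmem
      unfold Crosses at h3
      exact phi_singleton_eq_one.1 (by omega)
    have hs := stretch_eq hq.isReduced hk0 hklt fun m hm h0 hmk =>
      fst_eq_one_of_level_eq hm (by rw [hlev m h0 hmk.le, hlev (m + 1) (by omega) hmk])
    rw [hVk, hV0, expSum_take_drop, show 0 + 1 + (k - (0 + 1)) = k by omega, List.drop_zero,
      expSum_take_succ 1 V (by omega), hV0, List.take_zero] at hs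
    rw [expSum_nil, expSum_singleton, if_neg (by decide), add_zero, sub_zero] at hs
    rw [← hs]
    exact (List.take_prefix _ _).isInfix
  · right
    set k := (heightOne V).getLastD 0 with hk
    have hkmem : k ∈ heightOne V := by
      rw [hk, List.getLastD_eq_getLast?, List.getLast?_eq_some_getLast hne]
      exact List.getLast_mem hne
    have hmax : ∀ m, k < m → ¬ Crosses (level V) 1 m := by
      intro m hm hc
      have hmem := mem_heightOne.2 hc
      rw [← List.dropLast_append_getLast hne] at hmem hsort
      rw [List.getLastD_eq_getLast?, List.getLast?_eq_some_getLast hne, Option.getD_some] at hk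
      rcases List.mem_append.1 hmem with h | h
      · have := (List.pairwise_append.1 hsort).2.2 m h _ (List.mem_singleton_self _)
        omega
      · rw [List.mem_singleton] at h
        omega
    obtain ⟨hk0, hklt⟩ := pos_of_mem_heightOne hkmem
    have hlev : ∀ m, k < m → m ≤ V.length - 1 → level V m = 1 := fun m =>
      level_eq_one_of_forall_gt hV hup hmax
    have hlast : V[V.length - 1]'(by omega) = lX' := by
      have := getLast_eq hV hup
      rw [List.getLast?_eq_getElem?, List.getElem?_eq_getElem (by omega)] at this
      exact Option.some.inj this
    have h3 := mem_heightOne.1 hkmem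
    have hk1 : k < V.length - 1 := by
      by_contra hcon
      have h4 := level_pred_length hV hup
      have h5 : level V V.length = 0 := by rw [level, List.take_length]; exact hV.1.2
      rw [show k = V.length - 1 by omega, Crosses, show V.length - 1 + 1 = V.length by omega] at h3
      omega
    have hVk : V[k] = lX' := by
      have h1 := level_succ hklt
      have h2 := hlev (k + 1) (by omega) (by omega)
      unfold Crosses at h3
      exact phi_singleton_eq_neg_one.1 (by omega)
    have hs := stretch_eq hq.isReduced hk1 (by omega) fun m hm h0 hmk =>
      fst_eq_one_of_level_eq hm (by
        rw [hlev m h0 hmk.le, hlev (m + 1) (by omega) (by omega)])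
    have hE : expSum 1 ((V.drop (k + 1)).take (V.length - 1 - (k + 1))) =
        expSum 1 (V.drop k) := by
      rw [expSum_take_drop, show k + 1 + (V.length - 1 - (k + 1)) = V.length - 1 by omega,
        expSum_take_succ 1 V hklt, hVk, expSum_drop]
      have h6 := expSum_take_succ 1 V (i := V.length - 1) (by omega)
      rw [show V.length - 1 + 1 = V.length by omega, List.take_length, hlast] at h6
      rw [h6, expSum_singleton, if_neg (by decide)]
      ring
    rw [hVk, hlast, hE] at hs
    rw [neg_neg, ← hs]
    exact (List.take_prefix _ _).isInfix.trans (List.drop_suffix _ _).isInfix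

end Upward

theorem elementaryCount_sub {W : List Letter} (hP : IsPrimitiveDiskWord W)
    (hq : IsQuasiGeometricWord W) (hx : xCount W = 2) :
    (elementaryCount W).1 - (elementaryCount W).2 = expSum 1 W := by
  have hlen := hP.two_le_length
  obtain ⟨⟨h, -⟩, -⟩ := hP
  obtain ⟨a, M, b, rfl⟩ : ∃ a M b, W = a :: (M ++ [b]) := by
    match W with
    | a :: b :: W =>
      refine ⟨a, (b :: W).dropLast, (b :: W).getLast (by simp), ?_⟩
      rw [List.dropLast_append_getLast]
  have hM : M <:+: a :: (M ++ [b]) := ⟨[a], [b], by simp⟩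
  rw [← List.cons_append, List.getLast?_concat, List.cons_append, List.head?_cons,
    Option.some.injEq, Option.some.injEq, Option.some.injEq, Option.some.injEq] at h
  have hM0 : xCount M = 0 := by
    rw [← List.singleton_append, xCount_append, xCount_append] at hx
    have h2 : xCount [a] = 1 ∧ xCount [b] = 1 := by
      rcases h with ⟨rfl, rfl⟩ | ⟨rfl, rfl⟩ <;> decide
    omega
  have hMk := eq_yPow_of_isReduced (hq.isReduced.infix hM) (fst_eq_one_of_xCount_eq_zero hM0)
  generalize expSum 1 M = k at hMk
  subst hMk
  have hk : |k| = 1 := by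
    rcases h with ⟨rfl, rfl⟩ | ⟨rfl, rfl⟩
    · exact hq.turn_up k List.infix_rfl
    · exact hq.turn_down k List.infix_rfl
  rcases (abs_eq one_pos.le).1 hk with rfl | rfl <;>
    rcases h with ⟨rfl, rfl⟩ | ⟨rfl, rfl⟩ <;> decide

/-- The difference `n_z - n_w` of the base point numbers of a primitive disk word is its exponent
sum in `Y`.  The word need not lie in a fixed relator, because the recursion inverts letters. -/
theorem basepoints_sub (W : List Letter) (hP : IsPrimitiveDiskWord W)
    (hq : IsQuasiGeometricWord W) :
    (basepoints W).1 - (basepoints W).2 = expSum 1 W := by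
  induction hn : W.length using Nat.strong_induction_on generalizing W with
  | _ n ih =>
    subst hn
    rw [basepoints]
    split_ifs with hx
    · exact elementaryCount_sub hP hq hx
    · apply fromUpwardPositive_sub
      set V := toUpwardPositive W with hVdef
      have hVP : IsPrimitiveDiskWord V := hP.toUpwardPositive
      have hVq : IsQuasiGeometricWord V := hq.toUpwardPositive
      have hup : IsUpward V := isUpward_toUpwardPositive hP
      have hVx : xCount V ≠ 2 := by rwa [hVdef, xCount_toUpwardPositive]
      have hlen : V.length = W.length := length_toUpwardPositive W
      have hsum : (((pieces V).attach.map fun U => basepoints U.1).sum).1 -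
          (((pieces V).attach.map fun U => basepoints U.1).sum).2 =
          ((pieces V).map (expSum 1)).sum := by
        let δ : ℤ × ℤ →+ ℤ := AddMonoidHom.fst ℤ ℤ - AddMonoidHom.snd ℤ ℤ
        change δ _ = _
        rw [map_list_sum, List.map_map, ← List.attach_map_val (l := pieces V) (f := expSum 1)]
        congr 1
        refine List.map_congr_left fun U _ => ?_
        exact ih U.1.length (hlen ▸ length_lt_of_mem_pieces U.2) U.1
          (isPrimitiveDiskWord_of_mem_pieces U.2) (hVq.infix (infix_of_mem_pieces U.2)) rfl
      have hsq := squareCount_sub rfl rfl (gap_ends hVP hup hVx hVq)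
      rw [sum_expSum_pieces (heightOne_ne_nil hVP hup hVx)] at hsum
      rw [expSum_drop] at hsq
      rw [Prod.fst_add, Prod.snd_add]
      omega

/-! ### The cyclic word as a walk -/

/-- The exponent sum of `g` in the initial subword of length `n` of the periodic infinite word
`R R R ...`. -/
def periodicSum (g : Fin 2) (R : List Letter) (n : ℕ) : ℤ :=
  (n / R.length : ℕ) * expSum g R + expSum g (R.take (n % R.length))

variable {R : List Letter}

theorem periodicSum_of_lt (g : Fin 2) {n : ℕ} (h : n < R.length) :
    periodicSum g R n = expSum g (R.take n) := by
  rw [periodicSum, Nat.div_eq_of_lt h, Nat.mod_eq_of_lt h]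
  simp

theorem periodicSum_add_mul (g : Fin 2) (hN : 0 < R.length) (n k : ℕ) :
    periodicSum g R (n + R.length * k) = periodicSum g R n + k * expSum g R := by
  rw [periodicSum, periodicSum, Nat.add_mul_mod_self_left, Nat.add_mul_div_left _ _ hN]
  push_cast
  ring

theorem periodicSum_succ (g : Fin 2) (hN : 0 < R.length) (n : ℕ) :
    periodicSum g R (n + 1) =
      periodicSum g R n + expSum g [R[n % R.length]'(Nat.mod_lt _ hN)] := by
  obtain ⟨p, k, hp, rfl⟩ : ∃ p k, p < R.length ∧ n = p + R.length * k :=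
    ⟨n % R.length, n / R.length, Nat.mod_lt _ hN, (Nat.mod_add_div _ _).symm⟩
  have hmod : (p + R.length * k) % R.length = p := by
    rw [Nat.add_mul_mod_self_left, Nat.mod_eq_of_lt hp]
  simp only [hmod]
  rw [show p + R.length * k + 1 = p + 1 + R.length * k by ring, periodicSum_add_mul g hN,
    periodicSum_add_mul g hN, periodicSum_of_lt g hp]
  have key : periodicSum g R (p + 1) = expSum g (R.take p) + expSum g [R[p]] := by
    rw [← expSum_take_succ g R hp]
    rcases Nat.lt_or_ge (p + 1) R.length with h | h
    · exact periodicSum_of_lt g h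
    · have h' : p + 1 = 0 + R.length * 1 := by omega
      rw [h', periodicSum_add_mul g hN, periodicSum_of_lt g hN, ← h', List.take_of_length_le h]
      simp
  rw [key]
  ring

theorem expSum_take_rotate (g : Fin 2) (hN : 0 < R.length) (n : ℕ) {k : ℕ} (hk : k ≤ R.length) :
    expSum g ((R.rotate n).take k) = periodicSum g R (n + k) - periodicSum g R n := by
  induction k with
  | zero => simp
  | succ k ih =>
    rw [expSum_take_succ g _ (by rw [List.length_rotate]; omega), ih (by omega), ← add_assoc,
      periodicSum_succ g hN (n + k)]
    simp only [List.getElem_rotate, add_comm n k]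
    ring

theorem isWalk_periodicSum (hN : 0 < R.length) : IsWalk (periodicSum 0 R) := by
  intro n
  rw [periodicSum_succ 0 hN, add_sub_cancel_left]
  exact abs_phi_singleton_le _

theorem follows_of_prefix_rotate (hN : 0 < R.length) {W : List Letter} {n : ℕ}
    (h : W <+: R.rotate n) : Follows W (periodicSum 0 R) n := by
  intro k hk
  have hlen := h.length_le
  rw [List.length_rotate] at hlen
  rw [phi, ← expSum_take_rotate 0 hN n (hk.trans hlen), List.prefix_iff_eq_take.1 h,
    List.take_take, min_eq_left hk]

theorem Crosses.height_unique {h : ℕ → ℤ} {c c' : ℤ} {n : ℕ} (hc : Crosses h c n)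
    (hc' : Crosses h c' n) : c = c' := by
  unfold Crosses at *
  omega



theorem length_pos_of_phi (hφ : phi R = 1) : 0 < R.length := by
  rw [List.length_pos_iff]
  rintro rfl
  simp at hφ

theorem crosses_add_mul (hφ : phi R = 1) {c : ℤ} {n : ℕ} (k : ℕ) :
    Crosses (periodicSum 0 R) (c + k) (n + R.length * k) ↔ Crosses (periodicSum 0 R) c n := by
  have hN := length_pos_of_phi hφ
  have h1 := periodicSum_add_mul 0 hN n k
  have h2 := periodicSum_add_mul 0 hN (n + 1) k
  rw [show expSum 0 R = 1 from hφ, mul_one] at h1 h2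
  rw [Crosses, Crosses, show n + R.length * k + 1 = n + 1 + R.length * k by ring, h1, h2]
  omega

theorem abs_periodicSum_le {n : ℕ} (hN : 0 < R.length) : |periodicSum 0 R n| ≤ n := by
  induction n with
  | zero => simp [periodicSum]
  | succ n ih =>
    have := abs_le.1 (isWalk_periodicSum hN n)
    rw [abs_le] at *
    push_cast
    omega

/-- Each `X`-letter of `R` occurs in the periodic word `R R R ...` at one crossing of every large
height, since `φ(R) = 1`.  Its lift is the crossing of height `R.length`. -/
def lift (x : XLetter R) : ℕ :=
  x.1 + R.length *
    (R.length - min (periodicSum 0 R x.1) (periodicSum 0 R (x.1 + 1))).toNat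

theorem lift_mod (x : XLetter R) : lift x % R.length = x.1 := by
  rw [lift, Nat.add_mul_mod_self_left, Nat.mod_eq_of_lt x.1.2]

theorem lift_injective : Function.Injective (lift (R := R)) := by
  intro x y h
  apply Subtype.ext
  apply Fin.ext
  rw [← lift_mod x, ← lift_mod y, h]

theorem phi_xLetter (x : XLetter R) : phi [R[(x.1 : ℕ)]] = 1 ∨ phi [R[(x.1 : ℕ)]] = -1 := by
  have h := x.2
  rw [List.get_eq_getElem] at h
  change expSum 0 [R[(x.1 : ℕ)]] = 1 ∨ expSum 0 [R[(x.1 : ℕ)]] = -1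
  rw [expSum_singleton, if_pos h]
  split_ifs <;> simp

theorem crosses_lift (hφ : phi R = 1) (x : XLetter R) :
    Crosses (periodicSum 0 R) R.length (lift x) := by
  have hN := length_pos_of_phi hφ
  have h1 := periodicSum_succ 0 hN x.1
  simp only [Nat.mod_eq_of_lt x.1.2] at h1
  have h2 := phi_xLetter x
  have h3 := abs_le.1 (abs_periodicSum_le hN (n := x.1))
  have hx := x.1.2
  set k := (R.length - min (periodicSum 0 R x.1) (periodicSum 0 R (x.1 + 1))).toNat with hk
  have hkZ : (k : ℤ) = R.length - min (periodicSum 0 R x.1) (periodicSum 0 R (x.1 + 1)) := by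
    rw [hk]
    omega
  have : (R.length : ℤ) = min (periodicSum 0 R x.1) (periodicSum 0 R (x.1 + 1)) + k := by omega
  rw [lift, ← hk, this, crosses_add_mul hφ, Crosses]
  simp only [phi] at h2
  omega

theorem exists_lift_eq (hφ : phi R = 1) {n : ℕ} (h : Crosses (periodicSum 0 R) R.length n) :
    ∃ x : XLetter R, lift x = n := by
  have hN := length_pos_of_phi hφ
  have h1 := periodicSum_succ 0 hN n
  have hx : (R[n % R.length]'(Nat.mod_lt _ hN)).1 = 0 := by
    by_contra h0
    rw [expSum_singleton, if_neg h0] at h1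
    unfold Crosses at h
    omega
  let x : XLetter R := ⟨⟨n % R.length, Nat.mod_lt _ hN⟩, hx⟩
  refine ⟨x, ?_⟩
  have h2 := crosses_lift hφ x
  rw [lift] at h2 ⊢
  have h3 : (x.1 : ℕ) = n % R.length := rfl
  generalize (R.length - min (periodicSum 0 R x.1) (periodicSum 0 R (x.1 + 1))).toNat = k at *
  have e := Nat.mod_add_div n R.length
  have e1 : Crosses (periodicSum 0 R) (R.length - k : ℤ) (n % R.length) := by
    rw [← crosses_add_mul hφ k, sub_add_cancel, ← h3]
    exact h2
  have e2 : Crosses (periodicSum 0 R) (R.length - (n / R.length : ℕ) : ℤ) (n % R.length) := by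
    rw [← crosses_add_mul hφ (n / R.length), sub_add_cancel, e]
    exact h
  have := e1.height_unique e2
  have hkn : k = n / R.length := by omega
  rw [h3, hkn, e]

/-- A primitive disk word runs between consecutive lifts. -/
theorem Connects.consecutive (hφ : phi R = 1) {W : List Letter} {x y : XLetter R}
    (h : Connects R W x y) :
    lift x < lift y ∧ W.length = lift y + 1 - lift x ∧ W <+: R.rotate (lift x) ∧
      ∀ m, lift x < m → m < lift y → ¬ Crosses (periodicSum 0 R) R.length m := by
  have hN := length_pos_of_phi hφ
  obtain ⟨hP, hpre, hend⟩ := h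
  have hlen := hP.two_le_length
  have hpre' : W <+: R.rotate (lift x) := by rwa [← List.rotate_mod, lift_mod]
  obtain ⟨c, hc1, hc2, hc3⟩ := hP.crosses (isWalk_periodicSum hN)
    (follows_of_prefix_rotate hN hpre')
  obtain rfl := (crosses_lift hφ x).height_unique hc1
  obtain ⟨z, hz⟩ := exists_lift_eq hφ hc2
  have : z = y := by
    apply Subtype.ext
    apply Fin.ext
    rw [← lift_mod z, hz, ← hend, Nat.add_sub_assoc (by omega), Nat.add_sub_assoc (by omega),
      ← Nat.mod_add_mod, lift_mod]
  subst this
  rw [← hz] at hc3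
  exact ⟨by omega, by omega, hpre', hc3⟩

/-- Consecutive crossings of the same height are less than one period apart, since the walk rises
by one in each period: otherwise a crossing, moved by one period, would lie on the wrong side of the
walk in between. -/
theorem lt_add_length_of_consecutive (hφ : phi R = 1) {c : ℤ} {m n : ℕ} (hmn : m < n)
    (hm : Crosses (periodicSum 0 R) c m) (hn : Crosses (periodicSum 0 R) c n)
    (h : ∀ t, m < t → t < n → ¬ Crosses (periodicSum 0 R) c t) : n < m + R.length := by
  have hN := length_pos_of_phi hφ
  have hper : ∀ t, periodicSum 0 R (t + R.length) = periodicSum 0 R t + 1 := by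
    intro t
    have := periodicSum_add_mul 0 hN t 1
    rw [show expSum 0 R = 1 from hφ] at this
    simpa using this
  by_contra! hcon
  -- The first crossing is upwards or downwards, and the walk then stays above or below.
  rcases hm with hm | hm
  · have hab := (isWalk_periodicSum hN).above hm.2 h
    have h1 := hab n hmn le_rfl
    have h2 : periodicSum 0 R (n + 1) = c := by unfold Crosses at hn; omega
    have h3 := hper (m + 1)
    rw [show m + 1 + R.length = m + R.length + 1 by ring] at h3
    rcases hcon.eq_or_lt with h4 | h4
    · rw [h4] at h3
      omega
    · have h5 := hper (n - R.length)
      rw [Nat.sub_add_cancel (by omega)] at h5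
      have h6 := hab (n - R.length) (by omega) (by omega)
      unfold Crosses at hn
      omega
  · have := (isWalk_periodicSum hN).below hm.2 h (m + R.length) (by omega) hcon
    have := hper m
    omega

/-- Consecutive lifts are joined by a primitive disk word. -/
theorem exists_connects (hφ : phi R = 1) {x y : XLetter R} (hxy : lift x < lift y)
    (h : ∀ m, lift x < m → m < lift y → ¬ Crosses (periodicSum 0 R) R.length m) :
    ∃ W, Connects R W x y := by
  have hN := length_pos_of_phi hφ
  have hx := crosses_lift hφ x
  have hy := crosses_lift hφ y
  have hlt := lt_add_length_of_consecutive hφ hxy hx hy h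
  have hpre := List.take_prefix (lift y + 1 - lift x) (R.rotate (lift x))
  have hlen : ((R.rotate (lift x)).take (lift y + 1 - lift x)).length = lift y + 1 - lift x := by
    rw [List.length_take, List.length_rotate]
    omega
  refine ⟨_, isPrimitiveDiskWord_of_crosses (isWalk_periodicSum hN) hxy hx hy h
    (follows_of_prefix_rotate hN hpre) hlen, ?_, ?_⟩
  · have hrot : R.rotate (lift x) = R.rotate x.1 := by rw [← List.rotate_mod, lift_mod]
    rwa [hrot] at hpre ⊢
  · rw [hlen, ← lift_mod x, Nat.add_sub_assoc (by omega), Nat.mod_add_mod,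
      ← Nat.add_sub_assoc (by omega), show lift x + (lift y + 1 - lift x) - 1 = lift y by omega,
      lift_mod]

/-- A function on the generators that agrees at the ends of every primitive disk word is
constant. -/
theorem eq_of_forall_connects (hφ : phi R = 1) {α : Type*} (u : XLetter R → α)
    (hu : ∀ W x y, Connects R W x y → u x = u y) (x y : XLetter R) : u x = u y := by
  have key : ∀ (n : ℕ) (x y : XLetter R), lift x < lift y → lift y - lift x = n → u x = u y := by
    intro n
    induction n using Nat.strong_induction_on with
    | _ n ih =>
      intro x y hxy hn
      by_cases h : ∃ m, lift x < m ∧ m < lift y ∧ Crosses (periodicSum 0 R) R.length m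
      · obtain ⟨m, h1, h2, h3⟩ := h
        obtain ⟨z, rfl⟩ := exists_lift_eq hφ h3
        exact (ih _ (by omega) x z h1 rfl).trans (ih _ (by omega) z y h2 rfl)
      · push Not at h
        obtain ⟨W, hW⟩ := exists_connects hφ hxy h
        exact hu W x y hW
  rcases lt_trichotomy (lift x) (lift y) with h | h | h
  · exact key _ x y h rfl
  · rw [lift_injective h]
  · exact (key _ y x h rfl).symm

/-- At most one primitive disk word starts at a given letter. -/
theorem Connects.word_unique {W W' : List Letter} {x y y' : XLetter R} (h : Connects R W x y)
    (h' : Connects R W' x y') : W = W' := by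
  have key : ∀ {U U' : List Letter}, IsPrimitiveDiskWord U → IsPrimitiveDiskWord U' →
      U <+: U' → U = U' := by
    intro U U' hU hU' hp
    have := hU.two_le_length
    refine hp.eq_of_length (le_antisymm hp.length_le (not_lt.1 fun hlt => ?_))
    apply hU'.2 U.length (by omega) hlt
    rw [← List.prefix_iff_eq_take.1 hp]
    exact hU.1.2
  rcases List.prefix_or_prefix_of_prefix h.2.1 h'.2.1 with hp | hp
  · exact key h.1 h'.1 hp
  · exact (key h'.1 h.1 hp).symm

open Classical in
/-- The lifts of the generators are linearly ordered and primitive disk words join consecutive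
ones, so that every choice of differences is the coboundary of a grading. -/
theorem exists_potential (hφ : phi R = 1) (g : List Letter → ℤ) :
    ∃ M : XLetter R → ℤ, ∀ W x y, Connects R W x y → M x - M y = g W := by
  let step : ℕ → ℤ := fun m =>
    if h : ∃ W x y, lift x = m ∧ Connects R W x y then g h.choose else 0
  refine ⟨fun x => -∑ m ∈ Finset.range (lift x), step m, fun W x y hW => ?_⟩
  obtain ⟨hlt, -, -, hbetween⟩ := hW.consecutive hφ
  have hstep : step (lift x) = g W := by
    have h : ∃ W' x' y', lift x' = lift x ∧ Connects R W' x' y' := ⟨W, x, y, rfl, hW⟩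
    simp only [step, dif_pos h]
    obtain ⟨x', y', hx', hW'⟩ := h.choose_spec
    obtain rfl := lift_injective hx'
    rw [hW'.word_unique hW]
  have hzero : ∀ m ∈ Finset.Ico (lift x) (lift y), m ≠ lift x → step m = 0 := by
    intro m hm hne
    rw [Finset.mem_Ico] at hm
    refine dif_neg ?_
    rintro ⟨W', x', y', rfl, -⟩
    exact hbetween _ (by omega) hm.2 (crosses_lift hφ x')
  have hsum := Finset.sum_Ico_eq_sub step hlt.le
  rw [Finset.sum_eq_single (lift x) hzero (by simp [hlt]), hstep] at hsum
  rw [hsum]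
  ring

/-! ### The gradings -/

theorem getElem_mod_lift (x : XLetter R) (h : lift x % R.length < R.length) :
    R[lift x % R.length] = R[(x.1 : ℕ)] := by
  congr 1
  exact lift_mod x

/-- The ends of a primitive disk word have opposite signs. -/
theorem Connects.phi_eq_neg (hφ : phi R = 1) {W : List Letter} {x y : XLetter R}
    (h : Connects R W x y) : phi [R[(y.1 : ℕ)]] = -phi [R[(x.1 : ℕ)]] := by
  have hN := length_pos_of_phi hφ
  obtain ⟨hlt, hlen, hpre, hb⟩ := h.consecutive hφ
  have hx := crosses_lift hφ x
  have hy := crosses_lift hφ y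
  have h1 := periodicSum_succ 0 hN (lift x)
  have h2 := periodicSum_succ 0 hN (lift y)
  rw [getElem_mod_lift] at h1 h2
  have hfol := follows_of_prefix_rotate hN hpre W.length le_rfl
  rw [List.take_length, h.1.1.2, show lift x + W.length = lift y + 1 by omega] at hfol
  simp only [phi]
  unfold Crosses at hx hy
  omega

/-- The exponent of the image of a word in the infinite cyclic abelianization of
`⟨X, Y | R⟩`, if `φ(R) = 1`: the class of `Y` generates it and `X` is the power `-expSum 1 R` of
this class. -/
def abExp (R W : List Letter) : ℤ := expSum 1 W - expSum 1 R * expSum 0 W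

/-- The exponent of `t` in the term of the Fox derivative `∂R/∂X` that belongs to an `X`-letter.
It is the negative of the exponent of a prefix of `R`, which ends before the letter if this is `X`
and after it if it is `X⁻¹`; the letter `X⁻¹` itself contributes `expSum 1 R`. -/
def foxGrading (R : List Letter) (x : XLetter R) : ℤ :=
  -(abExp R (R.take x.1) + if (R.get x.1).2 then 0 else expSum 1 R)

theorem isAlexanderGrading_of_eq_expSum (hq : ∀ n, IsQuasiGeometricWord (R.rotate n))
    {F : XLetter R → ℤ} :
    IsAlexanderGrading R F ↔ ∀ W x y, Connects R W x y → F x - F y = expSum 1 W := by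
  refine forall_congr' fun W => forall_congr' fun x => forall_congr' fun y =>
    forall_congr' fun h => ?_
  rw [basepoints_sub W h.1 ((hq _).infix h.2.1.isInfix)]

theorem abExp_take_eq (hφ : phi R = 1) (x : XLetter R) :
    abExp R (R.take x.1) =
      periodicSum 1 R (lift x) - expSum 1 R * periodicSum 0 R (lift x) := by
  have hN := length_pos_of_phi hφ
  rw [lift, periodicSum_add_mul 1 hN, periodicSum_add_mul 0 hN, periodicSum_of_lt 1 x.1.2,
    periodicSum_of_lt 0 x.1.2, abExp, show expSum 0 R = 1 from hφ]
  ring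

theorem foxGrading_sub (hφ : phi R = 1) {W : List Letter} {x y : XLetter R}
    (h : Connects R W x y) : foxGrading R x - foxGrading R y = expSum 1 W := by
  have hN := length_pos_of_phi hφ
  obtain ⟨hlt, hlen, hpre, hb⟩ := h.consecutive hφ
  have hW : W.length ≤ R.length := by simpa using hpre.length_le
  have e1 := expSum_take_rotate 1 hN (lift x) hW
  have e0 := expSum_take_rotate 0 hN (lift x) hW
  rw [← List.prefix_iff_eq_take.1 hpre, show lift x + W.length = lift y + 1 by omega] at e0 e1
  rw [show expSum 0 W = 0 from h.1.1.2] at e0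
  have s1 := periodicSum_succ 1 hN (lift y)
  have s0 := periodicSum_succ 0 hN (lift y)
  rw [getElem_mod_lift] at s0 s1
  have hx2 := x.2
  have hy2 := y.2
  have hneg := h.phi_eq_neg hφ
  rw [foxGrading, foxGrading, abExp_take_eq hφ, abExp_take_eq hφ]
  simp only [phi, List.get_eq_getElem] at *
  rw [expSum_singleton, expSum_singleton, if_pos hx2, if_pos hy2] at hneg
  rw [expSum_singleton, if_pos hy2] at s0
  rw [expSum_singleton, if_neg (by rw [hy2]; decide)] at s1
  have e0' : periodicSum 0 R (lift y + 1) = periodicSum 0 R (lift x) := by omega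
  have e1' : periodicSum 1 R (lift x) = periodicSum 1 R (lift y) - expSum 1 W := by omega
  rw [e1', ← e0', s0]
  cases hb1 : (R[(x.1 : ℕ)]).2 <;> cases hb2 : (R[(y.1 : ℕ)]).2 <;>
    simp [hb1, hb2] at hneg ⊢ <;> ring

theorem isQuasiGeometricWord_rotate (hR : IsQuasiGeometric R) (n : ℕ) :
    IsQuasiGeometricWord (R.rotate n) := by
  have key : ∀ {U : List Letter}, U <:+: R.rotate n → IsCyclicSubword U R := by
    rintro U ⟨A, B, h⟩
    refine ⟨n + A.length, ?_⟩
    rw [← List.rotate_rotate, ← h, List.append_assoc, List.rotate_append_length_eq,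
      List.append_assoc]
    exact List.prefix_append _ _
  refine ⟨?_, fun k hk => hR.turn_up k (key hk), fun k hk => hR.turn_down k (key hk),
    fun l l' hl hl' => hR.gap l l' (hl.imp key key) (hl'.imp key key)⟩
  have h2 := (hR.cyclicallyReduced.flatten_replicate 2).isReduced
  refine h2.infix ?_
  rw [List.rotate_eq_drop_append_take_mod]
  refine ⟨R.take (n % R.length), R.drop (n % R.length), ?_⟩
  simp [List.replicate_succ, ← List.append_assoc]
  simp [List.append_assoc]

theorem exists_add_const {F F' : XLetter R → ℤ} (hφ : phi R = 1)
    (h : ∀ W x y, Connects R W x y → F x - F y = F' x - F' y) :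
    ∃ c : ℤ, ∀ x, F' x = F x + c := by
  have key := eq_of_forall_connects hφ (fun x => F' x - F x) fun W x y hW => by
    have := h W x y hW
    omega
  rcases isEmpty_or_nonempty (XLetter R) with hE | ⟨⟨x₀⟩⟩
  · exact ⟨0, fun x => hE.elim x⟩
  · exact ⟨F' x₀ - F x₀, fun x => by have := key x x₀; omega⟩

/-- Up to a common sign, `(-1)^M` is the sign of the letter. -/
theorem exists_sign (hφ : phi R = 1) {M : XLetter R → ℤ} (hM : IsMaslovGrading R M) :
    ∃ κ : ℤˣ, ∀ x, ((M x).negOnePow : ℤ) = κ * phi [R[(x.1 : ℕ)]] := by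
  have key := eq_of_forall_connects hφ
    (fun x => ((M x).negOnePow : ℤ) * phi [R[(x.1 : ℕ)]]) fun W x y hW => by
      have h1 := hM W x y hW
      have h2 := hW.phi_eq_neg hφ
      have h3 : (M x).negOnePow = -(M y).negOnePow := by
        rw [show M x = M y + ((if IsPositive W then 1 else -1) - 2 * (basepoints W).2) by omega,
          Int.negOnePow_add, Int.negOnePow_odd ((if IsPositive W then 1 else -1) - _)]
        · simp
        · split_ifs
          · exact ⟨-(basepoints W).2, by ring⟩
          · exact ⟨-(basepoints W).2 - 1, by ring⟩
      rw [h2, h3]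
      push_cast
      ring
  rcases isEmpty_or_nonempty (XLetter R) with hE | ⟨⟨x₀⟩⟩
  · exact ⟨1, fun x => hE.elim x⟩
  · have hsq : ∀ x : XLetter R, phi [R[(x.1 : ℕ)]] * phi [R[(x.1 : ℕ)]] = 1 := by
      intro x
      rcases phi_xLetter x with h | h <;> rw [h] <;> rfl
    have hκ : ∃ κ : ℤˣ, (κ : ℤ) = ((M x₀).negOnePow : ℤ) * phi [R[(x₀.1 : ℕ)]] := by
      rcases phi_xLetter x₀ with h | h
      · exact ⟨(M x₀).negOnePow, by rw [h, mul_one]⟩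
      · exact ⟨-(M x₀).negOnePow, by rw [h]; simp⟩
    obtain ⟨κ, hκ⟩ := hκ
    refine ⟨κ, fun x => ?_⟩
    have := key x x₀
    rw [hκ, ← this, mul_assoc, hsq, mul_one]

open LaurentPolynomial

/-! ### Units of the ring of Laurent polynomials -/

theorem isUnit_laurentPolynomial_iff {u : LaurentPolynomial ℤ} :
    IsUnit u ↔ ∃ c : ℤ, u = T c ∨ u = -T c := by
  constructor
  · rintro hu
    obtain ⟨v, huv⟩ := hu.exists_right_inv
    obtain ⟨n, p, hp⟩ := exists_T_pow u
    obtain ⟨m, q, hq⟩ := exists_T_pow v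
    have hpq : p * q = Polynomial.X ^ (n + m) := by
      apply Polynomial.toLaurent_injective
      rw [map_mul, hp, hq, Polynomial.toLaurent_X_pow, mul_mul_mul_comm, huv, one_mul, ← T_add]
      push_cast
      rfl
    obtain ⟨i, -, w, hw⟩ := (dvd_prime_pow Polynomial.prime_X (n + m)).1 (Dvd.intro q hpq)
    obtain ⟨r, hr, hrw⟩ := Polynomial.isUnit_iff.1 w.isUnit
    have hu' : u = Polynomial.toLaurent p * T (-n) := by
      rw [hp, mul_assoc, ← T_add, add_neg_cancel, T_zero, mul_one]
    have hpw : p * Polynomial.C r = Polynomial.X ^ i := by rw [hrw, hw]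
    refine ⟨i - n, ?_⟩
    rw [hu', sub_eq_add_neg, T_add, ← Polynomial.toLaurent_X_pow, ← hpw]
    rcases Int.isUnit_iff.1 hr with rfl | rfl
    · left; simp
    · right; simp
  · rintro ⟨c, rfl | rfl⟩
    · exact isUnit_T c
    · exact (isUnit_T c).neg

theorem eqUpToUnit_iff_span_eq {f g : LaurentPolynomial ℤ} :
    EqUpToUnit f g ↔ Ideal.span {f} = Ideal.span {g} := by
  rw [Ideal.span_singleton_eq_span_singleton]
  constructor
  · rintro ⟨c, rfl | rfl⟩
    · exact associated_unit_mul_left _ _ (isUnit_T c)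
    · rw [← neg_mul]
      exact associated_unit_mul_left _ _ (isUnit_T c).neg
  · rintro h
    obtain ⟨u, rfl⟩ := h.symm
    obtain ⟨c, hc | hc⟩ := isUnit_laurentPolynomial_iff.1 u.isUnit
    · exact ⟨c, Or.inl (by rw [hc, mul_comm])⟩
    · exact ⟨c, Or.inr (by rw [hc]; ring)⟩

/-- The generator of the ideal is determined by a cyclic module, as its annihilator. -/
theorem isAlexanderPolynomial_iff_eqUpToUnit {G : Type*} [Group G] {s : G}
    {f : LaurentPolynomial ℤ} (hf : IsAlexanderPolynomial s f) (Δ : LaurentPolynomial ℤ) :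
    IsAlexanderPolynomial s Δ ↔ EqUpToUnit f Δ := by
  obtain ⟨h1, ⟨e⟩⟩ := hf
  rw [eqUpToUnit_iff_span_eq]
  constructor
  · rintro ⟨-, ⟨e'⟩⟩
    have := (e.symm.trans e').annihilator_eq
    rwa [Ideal.annihilator_quotient, Ideal.annihilator_quotient] at this
  · intro h
    exact ⟨h1, ⟨e.trans (Submodule.quotEquivOfEq _ _ h)⟩⟩

/-! ### The Fox derivative of a word -/

/-- The Fox derivative by `X` of a letter, in `ℤ[t, t⁻¹]`. -/
noncomputable def foxLetter (R : List Letter) (a : Letter) : LaurentPolynomial ℤ :=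
  if a.1 = 0 then (if a.2 then 1 else -T (-expSum 1 R)) else 0

/-- The Fox derivative by `X` of a word, in `ℤ[t, t⁻¹]`.  A group element of exponent `n` in the
infinite cyclic abelianization of `⟨X, Y | R⟩` becomes `t ^ (-n)`, because `t` acts by conjugation
with the inverse of `Y`. -/
noncomputable def foxDeriv (R : List Letter) : List Letter → LaurentPolynomial ℤ
  | [] => 0
  | a :: W => foxLetter R a + T (-abExp R [a]) * foxDeriv R W

theorem abExp_append (R U V : List Letter) : abExp R (U ++ V) = abExp R U + abExp R V := by
  rw [abExp, abExp, abExp, expSum_append, expSum_append]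
  ring

theorem abExp_cons (R : List Letter) (a : Letter) (V : List Letter) :
    abExp R (a :: V) = abExp R [a] + abExp R V :=
  abExp_append R [a] V

theorem abExp_self {R : List Letter} (hφ : phi R = 1) : abExp R R = 0 := by
  rw [abExp, show expSum 0 R = 1 from hφ]
  ring

theorem foxDeriv_concat (R W : List Letter) (a : Letter) :
    foxDeriv R (W ++ [a]) = foxDeriv R W + T (-abExp R W) * foxLetter R a := by
  induction W with
  | nil => simp [foxDeriv, abExp]
  | cons b W ih =>
    rw [List.cons_append, foxDeriv, ih, foxDeriv, abExp_cons R b W, neg_add, T_add]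
    ring

theorem foxDeriv_take (R : List Letter) {n : ℕ} (hn : n ≤ R.length) :
    foxDeriv R (R.take n) =
      ∑ i : Fin n, T (-abExp R (R.take i)) * foxLetter R (R[(i : ℕ)]'(by omega)) := by
  induction n with
  | zero => simp [foxDeriv]
  | succ n ih =>
    rw [List.take_succ_eq_append_getElem (by omega), foxDeriv_concat, ih (by omega),
      Fin.sum_univ_castSucc]
    rfl

/-- The terms of the Fox derivative of `R` correspond to the `X`-letters. -/
theorem foxDeriv_self (R : List Letter) :
    foxDeriv R R = ∑ x : XLetter R, C (phi [R[(x.1 : ℕ)]]) * T (foxGrading R x) := by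
  have h := foxDeriv_take R le_rfl
  rw [List.take_length] at h
  rw [h, ← Finset.sum_filter_of_ne (p := fun i : Fin R.length => (R.get i).1 = 0),
    Finset.sum_subtype _ (p := fun i : Fin R.length => (R.get i).1 = 0) (by simp)]
  · refine Finset.sum_congr rfl fun x _ => ?_
    have hx := x.2
    rw [List.get_eq_getElem] at hx
    simp only [foxLetter, foxGrading, phi, List.get_eq_getElem]
    rw [expSum_singleton, if_pos hx, if_pos hx]
    split_ifs
    · rw [add_zero, map_one, one_mul, mul_one]
    · rw [neg_add, T_add, map_neg, map_one]
      ring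
  · intro i _ hi
    by_contra h0
    apply hi
    rw [List.get_eq_getElem] at h0
    rw [foxLetter, if_neg h0, mul_zero]

/-! ### The Alexander module of a group with an infinite cyclic abelianization -/

section CrossedHom

variable {G : Type*} [Group G] {s : G}

theorem AlexanderModule.mk_mul (c c' : commutator G) :
    AlexanderModule.mk s (c * c') = AlexanderModule.mk s c + AlexanderModule.mk s c' := by
  change Additive.ofMul (Abelianization.of (c * c')) = _
  rw [map_mul]
  rfl

/-- Conjugation by an element of the commutator subgroup acts trivially, so that `t` acts by
conjugation with every element that has the same class as `s` in the abelianization. -/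
theorem AlexanderModule.mk_conjNormal_congr {g g' : G}
    (h : Abelianization.of g = Abelianization.of g') (c : commutator G) :
    AlexanderModule.mk s (MulAut.conjNormal g c) =
      AlexanderModule.mk s (MulAut.conjNormal g' c) := by
  have hk : g'⁻¹ * g ∈ commutator G := by
    rw [← Abelianization.ker_of, MonoidHom.mem_ker, map_mul, map_inv, h, inv_mul_cancel]
  let k : commutator G := ⟨g'⁻¹ * g, hk⟩
  have h1 : MulAut.conjNormal g c = MulAut.conjNormal g' (k * c * k⁻¹) := by
    apply Subtype.ext
    simp only [MulAut.conjNormal_apply, k, Subgroup.coe_mul, Subgroup.coe_inv]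
    group
  have h2 : AlexanderModule.mk s (k * c * k⁻¹) = AlexanderModule.mk s c := by
    refine congrArg Additive.ofMul (?_ : Abelianization.of (k * c * k⁻¹) = Abelianization.of c)
    rw [map_mul, map_mul, map_inv, mul_comm, inv_mul_cancel_left]
  rw [h1, ← conjAction_mk, h2, conjAction_mk]

theorem T_smul_mk_of_eq {y : G} (hy : Abelianization.of s = Abelianization.of y) (n : ℤ)
    (c : commutator G) :
    (T n : LaurentPolynomial ℤ) • AlexanderModule.mk s c =
      AlexanderModule.mk s (MulAut.conjNormal (y ^ (-n)) c) := by
  rw [T_smul_mk]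
  apply AlexanderModule.mk_conjNormal_congr
  rw [map_zpow, map_zpow, hy]

/-- An additive map into a module over the Laurent polynomials is linear if it commutes with the
powers of `t`. -/
theorem map_smul_of_map_T_smul {A B : Type*} [AddCommGroup A] [AddCommGroup B]
    [Module (LaurentPolynomial ℤ) A] [Module (LaurentPolynomial ℤ) B] (f : A →+ B)
    (hf : ∀ (n : ℤ) (a : A), f ((T n : LaurentPolynomial ℤ) • a) =
      (T n : LaurentPolynomial ℤ) • f a) (p : LaurentPolynomial ℤ) (a : A) :
    f (p • a) = p • f a := by
  induction p using LaurentPolynomial.induction_on' with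
  | add p q hp hq => rw [add_smul, add_smul, map_add, hp, hq]
  | C_mul_T n m =>
    have hC : (C m : LaurentPolynomial ℤ) = ((m : ℤ) : LaurentPolynomial ℤ) := by simp
    rw [mul_smul, mul_smul, hC, Int.cast_smul_eq_zsmul, Int.cast_smul_eq_zsmul, map_zsmul, hf]

variable (α : G →* Multiplicative ℤ) {y : G}
  (hα : ∀ g, Abelianization.of g = Abelianization.of y ^ (α g).toAdd)

include hα in
theorem mul_zpow_mem_commutator (g : G) : g * y ^ (-(α g).toAdd) ∈ commutator G := by
  rw [← Abelianization.ker_of, MonoidHom.mem_ker, map_mul, map_zpow, hα g, ← zpow_add,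
    add_neg_cancel, zpow_zero]

theorem map_eq_one_of_mem_commutator {g : G} (hg : g ∈ commutator G) : α g = 1 :=
  Abelianization.commutator_subset_ker α hg

/-- The crossed homomorphism `g ↦ [g y^(-α(g))]` into the Alexander module, if `α` is the
projection of `G` to its infinite cyclic abelianization, generated by the class of `y`. -/
def crossedHom (s : G) (g : G) : AlexanderModule s :=
  AlexanderModule.mk s ⟨g * y ^ (-(α g).toAdd), mul_zpow_mem_commutator α hα g⟩

theorem crossedHom_mul (hs : Abelianization.of s = Abelianization.of y) (g g' : G) :
    crossedHom α hα s (g * g') = crossedHom α hα s g +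
      (T (-(α g).toAdd) : LaurentPolynomial ℤ) • crossedHom α hα s g' := by
  rw [crossedHom, crossedHom, crossedHom, T_smul_mk_of_eq hs, ← AlexanderModule.mk_mul]
  congr 1
  apply Subtype.ext
  simp only [Subgroup.coe_mul, MulAut.conjNormal_apply, map_mul, toAdd_mul, neg_add, zpow_add,
    neg_neg, zpow_neg]
  group

theorem crossedHom_eq_zero {g : G} (hg : g * y ^ (-(α g).toAdd) = 1) :
    crossedHom α hα s g = 0 := by
  have h : (⟨g * y ^ (-(α g).toAdd), mul_zpow_mem_commutator α hα g⟩ : commutator G) = 1 :=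
    Subtype.ext hg
  rw [crossedHom, h]
  exact congrArg Additive.ofMul (map_one Abelianization.of)

theorem crossedHom_one : crossedHom α hα s 1 = 0 :=
  crossedHom_eq_zero α hα (by simp)

theorem crossedHom_inv (hs : Abelianization.of s = Abelianization.of y) (g : G) :
    crossedHom α hα s g⁻¹ =
      -((T (α g).toAdd : LaurentPolynomial ℤ) • crossedHom α hα s g) := by
  have h := crossedHom_mul α hα hs g⁻¹ g
  rw [inv_mul_cancel, crossedHom_one, map_inv, toAdd_inv, neg_neg] at h
  exact eq_neg_of_add_eq_zero_left h.symm

theorem crossedHom_coe (c : commutator G) :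
    crossedHom α hα s (c : G) = AlexanderModule.mk s c := by
  rw [crossedHom]
  congr 1
  apply Subtype.ext
  simp [map_eq_one_of_mem_commutator α c.2]

end CrossedHom

/-! ### Presentations with two generators and one relator -/

theorem freeGroup_mk_cons {ι : Type*} (a : ι × Bool) (W : List (ι × Bool)) :
    FreeGroup.mk (a :: W) = FreeGroup.mk [a] * FreeGroup.mk W := by
  rw [FreeGroup.mul_mk, List.singleton_append]

theorem freeGroup_mk_singleton {ι : Type*} (a : ι × Bool) :
    FreeGroup.mk [a] = if a.2 then FreeGroup.of a.1 else (FreeGroup.of a.1)⁻¹ := by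
  obtain ⟨i, b⟩ := a
  cases b <;> rfl

/-- A homomorphism to a commutative group depends only on the exponent sums. -/
theorem prod_pow_expSum {H : Type*} [CommGroup H] (φ : FreeGroup (Fin 2) →* H)
    (W : List Letter) :
    φ (FreeGroup.mk W) = φ (FreeGroup.of 0) ^ expSum 0 W * φ (FreeGroup.of 1) ^ expSum 1 W := by
  induction W with
  | nil => simp [← FreeGroup.one_eq_mk]
  | cons a W ih =>
    have ha : φ (FreeGroup.mk [a]) =
        φ (FreeGroup.of 0) ^ expSum 0 [a] * φ (FreeGroup.of 1) ^ expSum 1 [a] := by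
      obtain ⟨i, b⟩ := a
      rw [freeGroup_mk_singleton, expSum_singleton, expSum_singleton]
      fin_cases i <;> cases b <;> simp
    rw [freeGroup_mk_cons, map_mul, ih, ha, expSum_cons 0 a W, expSum_cons 1 a W, zpow_add, zpow_add,
      mul_mul_mul_comm]

/-- The affine map `v ↦ t^n v + b` of a module. -/
noncomputable def affinePerm {A : Type*} [AddCommGroup A] [Module (LaurentPolynomial ℤ) A]
    (n : ℤ) (b : A) : Equiv.Perm A where
  toFun v := (T n : LaurentPolynomial ℤ) • v + b
  invFun v := (T (-n) : LaurentPolynomial ℤ) • (v - b)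
  left_inv v := by
    beta_reduce
    rw [add_sub_cancel_right, ← mul_smul, ← T_add, neg_add_cancel, T_zero, one_smul]
  right_inv v := by
    beta_reduce
    rw [← mul_smul, ← T_add, add_neg_cancel, T_zero, one_smul, sub_add_cancel]

section Presentation

variable {R : List Letter}

/-- The action of the free group on a module by affine maps, where `X` acts by
`v ↦ t^(expSum 1 R) v + a` and `Y` by `v ↦ t⁻¹ v`. -/
noncomputable def affineAction (R : List Letter) {A : Type*} [AddCommGroup A]
    [Module (LaurentPolynomial ℤ) A] (a : A) : Fin 2 → Equiv.Perm A :=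
  ![affinePerm (expSum 1 R) a, affinePerm (-1) 0]

theorem lift_affineAction {A : Type*} [AddCommGroup A] [Module (LaurentPolynomial ℤ) A] (a : A)
    (W : List Letter) (v : A) :
    FreeGroup.lift (affineAction R a) (FreeGroup.mk W) v =
      (T (-abExp R W) : LaurentPolynomial ℤ) • v + foxDeriv R W • a := by
  induction W with
  | nil => simp [← FreeGroup.one_eq_mk, foxDeriv, abExp]
  | cons b W ih =>
    have hb : ∀ v, FreeGroup.lift (affineAction R a) (FreeGroup.mk [b]) v =
        (T (-abExp R [b]) : LaurentPolynomial ℤ) • v + foxLetter R b • a := by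
      intro v
      obtain ⟨i, c⟩ := b
      rw [freeGroup_mk_singleton, abExp, expSum_singleton, expSum_singleton, foxLetter]
      fin_cases i <;> cases c
      · change (T (-expSum 1 R) : LaurentPolynomial ℤ) • (v - a) = _
        simp [sub_eq_add_neg]
      · simp [affineAction, affinePerm]
      · change (T (-(-1)) : LaurentPolynomial ℤ) • (v - 0) = _
        simp
      · simp [affineAction, affinePerm]
    rw [freeGroup_mk_cons, map_mul, Equiv.Perm.mul_apply, ih, hb, abExp_cons R b W, foxDeriv, neg_add,
      T_add, smul_add, add_smul, mul_smul, mul_smul, add_assoc, add_comm (foxLetter R b • a)]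

/-- The Alexander module of the group of a presentation `⟨X, Y | R⟩` with `φ(R) = 1` is cyclic, and
its order ideal is generated by the Fox derivative of `R` by `X`.  The class of `X Y^(expSum 1 R)`
is a generator.  The affine action of the group on the cyclic module `ℤ[t, t⁻¹] / (∂R/∂X)` shows
that there are no further relations. -/
theorem isAlexanderPolynomial_foxDeriv (hφ : phi R = 1) {G : Type*} [Group G]
    (e : PresentedGroup {FreeGroup.mk R} ≃* G) (s : G)
    (hs : Abelianization.of s = Abelianization.of (e (PresentedGroup.of 1))) :
    IsAlexanderPolynomial s (foxDeriv R R) := by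
  set f := foxDeriv R R with hf
  set x := e (PresentedGroup.of 0) with hx
  set y := e (PresentedGroup.of 1) with hy
  let π : FreeGroup (Fin 2) →* G := e.toMonoidHom.comp (PresentedGroup.mk {FreeGroup.mk R})
  have hπsurj : Function.Surjective π :=
    e.surjective.comp (PresentedGroup.mk_surjective _)
  have hword : ∀ g : G, ∃ W, g = π (FreeGroup.mk W) := by
    intro g
    obtain ⟨w, rfl⟩ := hπsurj g
    exact ⟨w.toWord, by rw [FreeGroup.mk_toWord]⟩
  have hπR : π (FreeGroup.mk R) = 1 := by
    change e (PresentedGroup.mk _ (FreeGroup.mk R)) = 1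
    rw [PresentedGroup.one_of_mem (Set.mem_singleton _), map_one]
  have hπx : π (FreeGroup.of 0) = x := rfl
  have hπy : π (FreeGroup.of 1) = y := rfl
  -- A homomorphism out of the free group that kills `R` descends to `G`.
  have hdesc : ∀ {H : Type} [Group H] (u : Fin 2 → H), FreeGroup.lift u (FreeGroup.mk R) = 1 →
      ∃ θ : G →* H, ∀ w, θ (π w) = FreeGroup.lift u w := by
    intro H _ u hu
    have hrel : ∀ r ∈ ({FreeGroup.mk R} : Set _), FreeGroup.lift u r = 1 := by
      rintro r rfl
      exact hu
    refine ⟨(PresentedGroup.toGroup hrel).comp e.symm.toMonoidHom, fun w => ?_⟩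
    change PresentedGroup.toGroup hrel (e.symm (e (PresentedGroup.mk _ w))) = _
    rw [MulEquiv.symm_apply_apply]
    rfl
  -- The projection to the infinite cyclic abelianization.
  let ab : Fin 2 → Multiplicative ℤ := ![Multiplicative.ofAdd (-expSum 1 R), Multiplicative.ofAdd 1]
  have hab : ∀ W, FreeGroup.lift ab (FreeGroup.mk W) = Multiplicative.ofAdd (abExp R W) := by
    intro W
    rw [prod_pow_expSum]
    apply Multiplicative.toAdd.injective
    simp [ab, abExp]
    ring
  obtain ⟨α, hαπ⟩ := hdesc ab (by rw [hab, abExp_self hφ]; rfl)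
  have hαW : ∀ W, (α (π (FreeGroup.mk W))).toAdd = abExp R W := by
    intro W
    rw [hαπ, hab]
    rfl
  have hα : ∀ g, Abelianization.of g = Abelianization.of y ^ (α g).toAdd := by
    intro g
    have hcomm := fun W => prod_pow_expSum (Abelianization.of.comp π) W
    simp only [MonoidHom.comp_apply, hπx, hπy] at hcomm
    have hx' : Abelianization.of x = Abelianization.of y ^ (-expSum 1 R) := by
      have := hcomm R
      rw [hπR, map_one, show expSum 0 R = 1 from hφ, zpow_one] at this
      rw [zpow_neg]
      exact eq_inv_of_mul_eq_one_left this.symm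
    obtain ⟨W, rfl⟩ := hword g
    rw [hαW, hcomm, hx', ← zpow_mul, ← zpow_add, abExp]
    congr 1
    ring
  have hαx : (α x).toAdd = -expSum 1 R := by rw [← hπx, hαπ]; simp [ab]
  have hαy : (α y).toAdd = 1 := by rw [← hπy, hαπ]; simp [ab]
  refine ⟨?_, ?_⟩
  · intro a
    obtain ⟨g, rfl⟩ := QuotientGroup.mk_surjective a
    exact ⟨(α g).toAdd, by simp only [hs]; exact (hα g).symm⟩
  -- The crossed homomorphism is given by the Fox derivative.
  set D := crossedHom α hα s with hD
  have hDy : D y = 0 := crossedHom_eq_zero α hα (by simp [hαy])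
  have hDyinv : D y⁻¹ = 0 := by
    rw [hD, crossedHom_inv α hα hs, ← hD, hDy, smul_zero, neg_zero]
  have hDW : ∀ W, D (π (FreeGroup.mk W)) = foxDeriv R W • D x := by
    intro W
    induction W with
    | nil => rw [← FreeGroup.one_eq_mk, map_one, hD, crossedHom_one, foxDeriv, zero_smul]
    | cons a W ih =>
      have ha : D (π (FreeGroup.mk [a])) = foxLetter R a • D x := by
        obtain ⟨i, b⟩ := a
        rw [freeGroup_mk_singleton, foxLetter]
        have hi : i = 0 ∨ i = 1 := by clear ih; revert i; decide
        rcases hi with rfl | rfl <;> cases b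
        · simp [hπx, hD, crossedHom_inv α hα hs, hαx]
        · simp [hπx]
        · simp [hπy, hDyinv]
        · simp [hπy, hDy]
      rw [freeGroup_mk_cons, map_mul, hD, crossedHom_mul α hα hs, ← hD, ih, ha, hαW, foxDeriv,
        add_smul, mul_smul]
  have hfD : f • D x = 0 := by rw [hf, ← hDW, hπR, hD, crossedHom_one]
  -- The affine action on the cyclic module with one relation `f`.
  let Q := LaurentPolynomial ℤ ⧸ Ideal.span {f}
  let q : Q := Submodule.Quotient.mk 1
  have hfq : ∀ p : LaurentPolynomial ℤ, p • q = 0 ↔ p ∈ Ideal.span {f} := by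
    intro p
    rw [← Submodule.Quotient.mk_smul, Submodule.Quotient.mk_eq_zero, smul_eq_mul, mul_one]
  obtain ⟨θ, hθπ⟩ := hdesc (affineAction R q) (by
    ext v
    rw [lift_affineAction, abExp_self hφ, (hfq _).2 (Ideal.mem_span_singleton_self f)]
    simp)
  have hθ : ∀ g v, θ g v = (T (-(α g).toAdd) : LaurentPolynomial ℤ) • v + θ g 0 := by
    intro g v
    obtain ⟨W, rfl⟩ := hword g
    rw [hθπ, lift_affineAction, lift_affineAction, hαW, smul_zero, zero_add]
  have hθy : ∀ n : ℤ, θ (y ^ n) 0 = 0 := by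
    intro n
    rw [map_zpow]
    apply Equiv.Perm.zpow_apply_eq_self_of_apply_eq_self
    rw [← hπy, hθπ]
    simp [affineAction, affinePerm]
  have hθx : θ x 0 = q := by
    rw [← hπx, hθπ]
    simp [affineAction, affinePerm]
  let δ₀ : commutator G →* Multiplicative Q :=
    { toFun := fun c => Multiplicative.ofAdd (θ c 0)
      map_one' := by simp
      map_mul' := fun c c' => by
        rw [Subgroup.coe_mul, map_mul, Equiv.Perm.mul_apply, hθ,
          map_eq_one_of_mem_commutator α c.2, ← ofAdd_add, add_comm]
        simp }
  let δ : AlexanderModule s →+ Q :=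
    AddMonoidHom.toMultiplicativeRight.symm (Abelianization.lift δ₀)
  have hδmk : ∀ c : commutator G, δ (AlexanderModule.mk s c) = θ c 0 := fun c => rfl
  have hδT : ∀ (n : ℤ) (a : AlexanderModule s), δ ((T n : LaurentPolynomial ℤ) • a) =
      (T n : LaurentPolynomial ℤ) • δ a := by
    intro n a
    obtain ⟨c, rfl⟩ := AlexanderModule.mk_surjective s a
    rw [T_smul_mk_of_eq hs, hδmk, hδmk, MulAut.conjNormal_apply, map_mul, map_mul,
      Equiv.Perm.mul_apply, Equiv.Perm.mul_apply, ← zpow_neg, hθy, hθ, hθy, add_zero, map_zpow,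
      toAdd_zpow, hαy]
    simp
  have hδD : δ (D x) = q := by
    rw [hD, crossedHom, hδmk, map_mul, Equiv.Perm.mul_apply, hθy, hθx]
  -- Multiplication of the generator by Laurent polynomials is onto, with kernel `(f)`.
  let Φ := LinearMap.toSpanSingleton (LaurentPolynomial ℤ) (AlexanderModule s) (D x)
  have hΦsurj : Function.Surjective Φ := by
    intro a
    obtain ⟨c, rfl⟩ := AlexanderModule.mk_surjective s a
    obtain ⟨W, hW⟩ := hword (c : G)
    refine ⟨foxDeriv R W, ?_⟩
    rw [LinearMap.toSpanSingleton_apply, ← hDW, ← hW, hD, crossedHom_coe]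
  have hΦker : LinearMap.ker Φ = Ideal.span {f} := by
    ext p
    rw [LinearMap.mem_ker, LinearMap.toSpanSingleton_apply]
    constructor
    · intro hp
      rw [← hfq, ← hδD, ← map_smul_of_map_T_smul δ hδT, hp, map_zero]
    · intro hp
      obtain ⟨r, rfl⟩ := Ideal.mem_span_singleton'.1 hp
      rw [mul_smul, hfD, smul_zero]
  exact ⟨((Submodule.quotEquivOfEq _ _ hΦker.symm).trans
    (Φ.quotKerEquivOfSurjective hΦsurj)).symm⟩

end Presentation

/-! ### The Euler characteristic -/

theorem gradedEulerChar_chainComplex {R : List Letter} (F M : XLetter R → ℤ) :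
    gradedEulerChar (chainComplex F M) =
      ∑ x, C ((M x).negOnePow : ℤ) * T (F x) := by
  classical
  have hrank : ∀ p : ℤ × ℤ, Module.finrank ℤ ((chainComplex F M p.2).X p.1) =
      (Finset.univ.filter fun x : XLetter R => (M x, F x) = p).card := by
    intro p
    change Module.finrank ℤ ({x : XLetter R // F x = p.2 ∧ M x = p.1} →₀ ℤ) = _
    rw [Module.finrank_finsupp_self, Fintype.card_subtype]
    congr 1
    ext x
    simp [Prod.ext_iff, and_comm]
  rw [gradedEulerChar, finsum_eq_sum_of_support_subset
    (s := Finset.univ.image fun x : XLetter R => (M x, F x))]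
  · rw [← Finset.sum_fiberwise_of_maps_to (t := Finset.univ.image fun x : XLetter R => (M x, F x))
      (g := fun x : XLetter R => (M x, F x)) (fun x _ => Finset.mem_image_of_mem _ (by simp))]
    refine Finset.sum_congr rfl fun p _ => ?_
    rw [hrank, Finset.sum_congr rfl (g := fun _ => C (p.1.negOnePow : ℤ) * T p.2), Finset.sum_const]
    · rw [map_mul]
      simp [nsmul_eq_mul]
      ring
    · intro x hx
      rw [← (Finset.mem_filter.1 hx).2]
  · intro p hp
    rw [Function.mem_support, hrank] at hp
    have : (Finset.univ.filter fun x : XLetter R => (M x, F x) = p).Nonempty := by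
      rw [← Finset.card_pos, Nat.pos_iff_ne_zero]
      rintro h0
      rw [h0] at hp
      simp at hp
    obtain ⟨x, hx⟩ := this
    rw [Finset.mem_coe, Finset.mem_image]
    exact ⟨x, Finset.mem_univ _, (Finset.mem_filter.1 hx).2⟩

/-- For any gradings the Euler characteristic is the Fox derivative, up to a unit. -/
theorem eqUpToUnit_foxDeriv {R : List Letter} (hφ : phi R = 1) {F M : XLetter R → ℤ}
    (hF : ∀ W x y, Connects R W x y → F x - F y = expSum 1 W) (hM : IsMaslovGrading R M) :
    EqUpToUnit (∑ x, C ((M x).negOnePow : ℤ) * T (F x)) (foxDeriv R R) := by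
  obtain ⟨c, hc⟩ := exists_add_const hφ fun W x y h => (foxGrading_sub hφ h).trans (hF W x y h).symm
  obtain ⟨κ, hκ⟩ := exists_sign hφ hM
  have : ∑ x, C ((M x).negOnePow : ℤ) * T (F x) = C (κ : ℤ) * (T c * foxDeriv R R) := by
    rw [foxDeriv_self, Finset.mul_sum, Finset.mul_sum]
    refine Finset.sum_congr rfl fun x _ => ?_
    rw [hκ, hc, map_mul, T_add]
    ring
  refine ⟨c, ?_⟩
  rw [this]
  rcases Int.units_eq_one_or κ with rfl | rfl <;> simp

end OneOneKnot

theorem proposition5p1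
    (K : Set OneOneKnot.Sphere3) (_hK : OneOneKnot.IsOneOneKnot K) (b : ↥Kᶜ)
    (R : List OneOneKnot.Letter) (_hR : OneOneKnot.IsQuasiGeometric R)
    (e : PresentedGroup {FreeGroup.mk R} ≃* FundamentalGroup ↥Kᶜ b)
    (s : FundamentalGroup ↥Kᶜ b)
    (_hs : Abelianization.of s = Abelianization.of (e (PresentedGroup.of 1))) :
    (∃ F, OneOneKnot.IsAlexanderGrading R F) ∧
    (∀ F F', OneOneKnot.IsAlexanderGrading R F → OneOneKnot.IsAlexanderGrading R F' →
      ∃ c : ℤ, ∀ x, F' x = F x + c) ∧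
    (∃ M, OneOneKnot.IsMaslovGrading R M) ∧
    (∀ M M', OneOneKnot.IsMaslovGrading R M → OneOneKnot.IsMaslovGrading R M' →
      ∃ c : ℤ, ∀ x, M' x = M x + c) ∧
    ∀ F M, OneOneKnot.IsAlexanderGrading R F → OneOneKnot.IsMaslovGrading R M →
      OneOneKnot.gradedEulerChar (OneOneKnot.chainComplex F M) =
        ∑ x, LaurentPolynomial.C ((M x).negOnePow : ℤ) * LaurentPolynomial.T (F x) ∧
      ∀ Δ : LaurentPolynomial ℤ, OneOneKnot.IsAlexanderPolynomial s Δ ↔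
        OneOneKnot.EqUpToUnit
          (∑ x, LaurentPolynomial.C ((M x).negOnePow : ℤ) * LaurentPolynomial.T (F x)) Δ := by
  have hφ := _hR.phi_eq_one
  have hq := OneOneKnot.isQuasiGeometricWord_rotate _hR
  refine ⟨⟨OneOneKnot.foxGrading R, ?_⟩, ?_, ?_, ?_, ?_⟩
  · rw [OneOneKnot.isAlexanderGrading_of_eq_expSum hq]
    exact fun W x y h => OneOneKnot.foxGrading_sub hφ h
  · exact fun F F' hF hF' => OneOneKnot.exists_add_const hφ fun W x y h =>
      (hF W x y h).trans (hF' W x y h).symm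
  · exact OneOneKnot.exists_potential hφ fun W =>
      (if OneOneKnot.IsPositive W then 1 else -1) - 2 * (OneOneKnot.basepoints W).2
  · exact fun M M' hM hM' => OneOneKnot.exists_add_const hφ fun W x y h =>
      (hM W x y h).trans (hM' W x y h).symm
  · intro F M hF hM
    rw [OneOneKnot.isAlexanderGrading_of_eq_expSum hq] at hF
    refine ⟨OneOneKnot.gradedEulerChar_chainComplex F M, fun Δ => ?_⟩
    rw [OneOneKnot.isAlexanderPolynomial_iff_eqUpToUnit
        (OneOneKnot.isAlexanderPolynomial_foxDeriv hφ e s _hs),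
      OneOneKnot.eqUpToUnit_iff_span_eq, OneOneKnot.eqUpToUnit_iff_span_eq,
      OneOneKnot.eqUpToUnit_iff_span_eq.1 (OneOneKnot.eqUpToUnit_foxDeriv hφ hF hM)]
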